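/- Let $p\ge 1$ be an integer. For $h>0$ and $\omega\in\mathbb C$ consider on $\mathbb R$ the uniform mesh $x_j=jh$, $j\in\mathbb Z$, the space $V$ of continuous functions $\mathbb R\to\mathbb C$ that are polynomials of degree at most $p$ on each element $[x_j,x_{j+1}]$, and the form \[ B_\omega(u,v)=\int_{\mathbb R}\bigl(u'\,\overline{v'}-\omega^2 u\,\overline v\bigr)\,dx . \] A number $k\in\mathbb C$ is called a discrete wave number if there are $u\in V$ and $b\in\mathbb C\setminus\{0\}$ with $u(x_j)=b\,e^{ijkh}$ for all $j\in\mathbb Z$ and $B_\omega(u,v)=0$ for all compactly supported $v\in V$. The numerical cosine $R_p$ is the following rational function. On polynomials of degree at most $p$ let $a_z(f,g)=\int_0^1 f'g'\,dx-z^2\int_0^1 fg\,dx$, and let $S(z)$ be the $2\times 2$ Schur complement that results from the matrix of $a_z$ in the basis $1-x,\ x,\ x(1-x)x^i$ $(0\le i\le p-2)$ when the interior functions $x(1-x)x^i$ are eliminated. Then \[ R_p(z)=-\frac{S_{00}(z)+S_{11}(z)}{S_{01}(z)+S_{10}(z)} . \] Then there are $\delta>0$ and $C>0$, depending only on $p$,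 such that for all $h>0$ and all $\omega\in\mathbb C$ with $|\omega h|<\delta$: 1. the discrete dispersion relation is $\cos(kh)=R_p(\omega h)$, that is, $k\in\mathbb C$ is a discrete wave number if and only if $\cos(kh)=R_p(\omega h)$; 2. the dispersive error satisfies \[ \left|R_p(\omega h)-\cos(\omega h)-\frac12\left[\frac{p!}{(2p)!}\right]^2\frac{(\omega h)^{2p+2}}{2p+1}\right|\le C\,|\omega h|^{2p+4} . \] -/

import Mathlib

open Polynomial MeasureTheory

noncomputable section

namespace HpFEM

/-- The finite element functions of degree `p` on the uniform mesh `x_j = j h` of the real line: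
continuous functions that are polynomials of degree at most `p` on every element. -/
def IsFEFunction (p : ℕ) (h : ℝ) (u : ℝ → ℂ) : Prop :=
  Continuous u ∧
    ∀ j : ℤ, ∃ q : ℂ[X], q.natDegree ≤ p ∧
      ∀ x ∈ Set.Icc ((j : ℝ) * h) (((j : ℝ) + 1) * h), u x = q.eval (x : ℂ)

/-- The sesquilinear form `B_ω(u, v) = (u', v') - ω² (u, v)`. For finite element functions `u`, `v`
with `v` compactly supported, the derivatives exist away from the mesh points and the integrand is
bounded with bounded support, so the integral is a genuine one. -/
def helmholtzForm (ω : ℂ) (u v : ℝ → ℂ) : ℂ :=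
  ∫ x : ℝ, (deriv u x * (starRingEnd ℂ) (deriv v x) - ω ^ 2 * (u x * (starRingEnd ℂ) (v x)))

/-- `k` is a discrete wave number at frequency `ω`: there is a finite element solution of
`B_ω(u, v) = 0` (for all compactly supported finite element functions `v`) whose nodal values are
those of a nonzero plane wave, `u(x_j) = b e^{i j k h}`. -/
def IsDiscreteWaveNumber (p : ℕ) (h : ℝ) (ω k : ℂ) : Prop :=
  ∃ u : ℝ → ℂ, IsFEFunction p h u ∧
    (∃ b : ℂ, b ≠ 0 ∧
      ∀ j : ℤ, u ((j : ℝ) * h) = b * Complex.exp (Complex.I * (j : ℂ) * k * (h : ℂ))) ∧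
    ∀ v : ℝ → ℂ, IsFEFunction p h v → HasCompactSupport v → helmholtzForm ω u v = 0

/-- The bilinear form `∫₀¹ f' g' - z² ∫₀¹ f g` on the reference element, with `z = ω h`. -/
def elementForm (z : ℂ) (f g : ℝ[X]) : ℂ :=
  ((∫ x in (0 : ℝ)..1, f.derivative.eval x * g.derivative.eval x : ℝ) : ℂ)
    - z ^ 2 * ((∫ x in (0 : ℝ)..1, f.eval x * g.eval x : ℝ) : ℂ)

/-- The two vertex shape functions `1 - x` and `x` of the reference element. -/
def vertexShape : Fin 2 → ℝ[X] := ![1 - X, X]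

/-- The interior shape functions `x (1 - x) x^i`, `0 ≤ i ≤ p - 2`, of the reference element. For
`p ≥ 1` they span, together with the vertex shape functions, the polynomials of degree `≤ p`. -/
def bubbleShape (p : ℕ) (i : Fin (p - 1)) : ℝ[X] := X * (1 - X) * X ^ (i : ℕ)

/-- The element matrix after elimination of the interior degrees of freedom
(Schur complement of the interior block). -/
def condensedMatrix (p : ℕ) (z : ℂ) : Matrix (Fin 2) (Fin 2) ℂ :=
  Matrix.of (fun i j => elementForm z (vertexShape i) (vertexShape j))
    - Matrix.of (fun i j => elementForm z (vertexShape i) (bubbleShape p j))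
      * (Matrix.of (fun i j => elementForm z (bubbleShape p i) (bubbleShape p j)))⁻¹
      * Matrix.of (fun i j => elementForm z (bubbleShape p i) (vertexShape j))

/-- The numerical cosine `R_p(z)`, a rational function of `z = ω h`. With `S` the condensed element
matrix, the nodal values satisfy `S₁₀ ξ_{j-1} + (S₁₁ + S₀₀) ξ_j + S₀₁ ξ_{j+1} = 0`, which for
`ξ_j = b e^{i j k h}` and `S₀₁ = S₁₀` reads `cos (k h) = R_p(ω h)`. -/
def numericalCosine (p : ℕ) (z : ℂ) : ℂ :=
  -(condensedMatrix p z 0 0 + condensedMatrix p z 1 1)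
    / (condensedMatrix p z 0 1 + condensedMatrix p z 1 0)

end HpFEM

end

noncomputable section

namespace HpFEM

open Filter Topology Asymptotics

/-! The discrete problem can be solved explicitly on one element. Up to scaling, the `q`-th
derivative of `(x (1 - x))^q` is the Legendre polynomial `L_q`, and `u'' + z² u = z^(2m+2) L_q'` has
a polynomial solution of degree at most `q - 1`. Its residual is invisible to bubbles `g` of degree
at most `q`: integration by parts moves the derivative onto `g`, and `g'` has degree below `q`. With
`q ∈ {p, p + 1}` this yields one solution even about the midpoint (`q` odd) and one odd (`q` even),
which together span all vertex values (`elementSolution_ode`, `complexForm_elementSolution`).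

By this symmetry the condensed matrix has eigenvectors `(1, 1)` and `(-1, 1)`. If `e` and `o` denote
the corresponding ratios of flux to vertex value, then `R_p = (o + e) / (o - e)`. The true Helmholtz
solutions `cos (z (x - 1/2))` and `sin (z (x - 1/2))` have the ratios `-z tan (z/2)` and `z cot
(z/2)`, for which the same quotient is `cos z`. Pairing the equation for `u` with these
trigonometric functions gives the defects of `e` and `o` exactly, as moments of `(x (1 - x))^q`
(`solutionFlux_odd`, `solutionFlux_even`). After the weighting in `ratio_sub_cos` the defect of
index `q` has size `z^(2q+2)`. So `q = p` gives the leading term, its constant being a Beta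
integral, and `q = p + 1` only enters the remainder.

For the dispersion relation, test functions living on two neighbouring elements force each piece of
a discrete solution to be an element solution and the fluxes at the common node to balance; on a
plane wave this balance is the cosine equation. Conversely, gluing element solutions with plane wave
nodal values makes the form telescope. -/

/-! ### The element form on complex polynomials -/

/-- The functional `f ↦ ∫₀¹ f` on complex polynomials. -/
def polyIntegral : ℂ[X] →ₗ[ℂ] ℂ where
  toFun f := ∫ x in (0 : ℝ)..1, f.eval (x : ℂ)
  map_add' f g := by
    simp only [eval_add]
    exact intervalIntegral.integral_add
      (Continuous.intervalIntegrable (by fun_prop) _ _)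
      (Continuous.intervalIntegrable (by fun_prop) _ _)
  map_smul' c f := by
    simp only [eval_smul, smul_eq_mul, RingHom.id_apply]
    exact intervalIntegral.integral_const_mul _ _

lemma polyIntegral_apply (f : ℂ[X]) :
    polyIntegral f = ∫ x in (0 : ℝ)..1, f.eval (x : ℂ) := rfl

lemma hasDerivAt_eval_ofReal (f : ℂ[X]) (x : ℝ) :
    HasDerivAt (fun t : ℝ => f.eval (t : ℂ)) (f.derivative.eval (x : ℂ)) x :=
  (f.hasDerivAt (x : ℂ)).comp_ofReal

lemma polyIntegral_derivative (f : ℂ[X]) :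
    polyIntegral (derivative f) = f.eval 1 - f.eval 0 := by
  rw [polyIntegral_apply, intervalIntegral.integral_eq_sub_of_hasDerivAt
    (fun x _ => hasDerivAt_eval_ofReal f x)
    (Continuous.intervalIntegrable (by fun_prop) _ _)]
  simp

lemma polyIntegral_derivative_mul (f g : ℂ[X]) :
    polyIntegral (derivative f * g)
      = f.eval 1 * g.eval 1 - f.eval 0 * g.eval 0 - polyIntegral (f * derivative g) := by
  have h := polyIntegral_derivative (f * g)
  rw [derivative_mul, map_add, eval_mul, eval_mul] at h
  rw [← h]; ring

lemma polyIntegral_map (f : ℝ[X]) :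
    polyIntegral (f.map (algebraMap ℝ ℂ)) = ((∫ x in (0 : ℝ)..1, f.eval x : ℝ) : ℂ) := by
  rw [polyIntegral_apply, ← intervalIntegral.integral_ofReal]
  refine intervalIntegral.integral_congr fun x _ => ?_
  have := eval_map_apply (algebraMap ℝ ℂ) (p := f) x
  simpa using this

/-- The form `elementForm` on complex polynomials (bilinear, without conjugation). -/
def complexForm (z : ℂ) : ℂ[X] →ₗ[ℂ] ℂ[X] →ₗ[ℂ] ℂ :=
  LinearMap.mk₂ ℂ
    (fun f g => polyIntegral (derivative f * derivative g) - z ^ 2 * polyIntegral (f * g))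
    (fun f f' g => by simp only [map_add, add_mul]; ring)
    (fun c f g => by simp only [smul_mul_assoc, map_smul, smul_eq_mul]; ring)
    (fun f g g' => by simp only [map_add, mul_add]; ring)
    (fun c f g => by simp only [mul_smul_comm, map_smul, smul_eq_mul]; ring)

lemma complexForm_apply (z : ℂ) (f g : ℂ[X]) :
    complexForm z f g
      = polyIntegral (derivative f * derivative g) - z ^ 2 * polyIntegral (f * g) := rfl

lemma complexForm_comm (z : ℂ) (f g : ℂ[X]) : complexForm z f g = complexForm z g f := by
  simp only [complexForm_apply, mul_comm]

lemma elementForm_eq_complexForm (z : ℂ) (f g : ℝ[X]) :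
    elementForm z f g
      = complexForm z (f.map (algebraMap ℝ ℂ)) (g.map (algebraMap ℝ ℂ)) := by
  rw [complexForm_apply, derivative_map, derivative_map, ← Polynomial.map_mul,
    ← Polynomial.map_mul, polyIntegral_map, polyIntegral_map]
  simp [elementForm]

/-- Integration by parts in the element form. -/
lemma complexForm_eq_boundary (z : ℂ) (f g : ℂ[X]) :
    complexForm z f g = (derivative f).eval 1 * g.eval 1 - (derivative f).eval 0 * g.eval 0
      - polyIntegral ((derivative (derivative f) + C (z ^ 2) * f) * g) := by
  have h := polyIntegral_derivative_mul (derivative f) g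
  rw [complexForm_apply, add_mul, map_add, mul_assoc, ← smul_eq_C_mul, map_smul, smul_eq_mul]
  rw [h]; ring

/-! ### Bubbles, element solutions and the Schur complement -/

/-- The bubble `x (1 - x) x^i` as a complex polynomial. -/
def bubble (i : ℕ) : ℂ[X] := X * (1 - X) * X ^ i

lemma map_bubbleShape (p : ℕ) (i : Fin (p - 1)) :
    (bubbleShape p i).map (algebraMap ℝ ℂ) = bubble i := by
  simp [bubbleShape, bubble]

/-- The vertex functions `1 - x` and `x` as complex polynomials. -/
def vertex : Fin 2 → ℂ[X] := ![1 - X, X]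

lemma map_vertexShape (i : Fin 2) :
    (vertexShape i).map (algebraMap ℝ ℂ) = vertex i := by
  fin_cases i <;> simp [vertexShape, vertex]

lemma bubble_eval_zero (i : ℕ) : (bubble i).eval 0 = 0 := by simp [bubble]

lemma bubble_eval_one (i : ℕ) : (bubble i).eval 1 = 0 := by simp [bubble]

lemma natDegree_one_sub_X_le : (1 - X : ℂ[X]).natDegree ≤ 1 :=
  (natDegree_sub_le _ _).trans (by simp)

lemma natDegree_bubble_le {p : ℕ} (i : Fin (p - 1)) : (bubble i).natDegree ≤ p := by
  have hi := i.2
  have h1 := natDegree_one_sub_X_le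
  have h2 : (X * (1 - X) : ℂ[X]).natDegree ≤ 2 :=
    natDegree_mul_le.trans (by rw [natDegree_X]; omega)
  refine natDegree_mul_le.trans ?_
  rw [natDegree_X_pow]
  omega

/-- A polynomial of degree at most `p` that vanishes at both vertices is a combination of
bubbles. -/
lemma exists_bubble_expansion {p : ℕ} {u : ℂ[X]} (hu : u.natDegree ≤ p)
    (h0 : u.eval 0 = 0) (h1 : u.eval 1 = 0) :
    ∃ c : Fin (p - 1) → ℂ, u = ∑ i, c i • bubble i := by
  have hX : (X : ℂ[X]) ∣ u := X_dvd_iff.2 (by rwa [coeff_zero_eq_eval_zero])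
  have hX1 : (X - C 1 : ℂ[X]) ∣ u := dvd_iff_isRoot.2 h1
  have hco : IsCoprime (X : ℂ[X]) (X - C 1) := ⟨1, -1, by simp⟩
  obtain ⟨r, hr⟩ := hco.mul_dvd hX hX1
  by_cases hr0 : r = 0
  · exact ⟨0, by simp [hr, hr0]⟩
  have hdeg : r.natDegree + 2 ≤ p := by
    have : u.natDegree = 2 + r.natDegree := by
      rw [hr, natDegree_mul (mul_ne_zero X_ne_zero (X_sub_C_ne_zero 1)) hr0,
        natDegree_mul X_ne_zero (X_sub_C_ne_zero 1), natDegree_X, natDegree_X_sub_C]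
    omega
  refine ⟨fun i => -r.coeff i, ?_⟩
  have hs : r = ∑ i : Fin (p - 1), C (r.coeff i) * X ^ (i : ℕ) := by
    rw [Fin.sum_univ_eq_sum_range (fun i => C (r.coeff i) * X ^ i) (p - 1)]
    exact r.as_sum_range_C_mul_X_pow' (by omega)
  conv_lhs => rw [hr, hs, Finset.mul_sum]
  refine Finset.sum_congr rfl fun i _ => ?_
  rw [smul_eq_C_mul, bubble, C_neg]
  simp only [map_one]
  ring

/-- `u` has degree at most `p` and is orthogonal to all bubbles in the element form. -/
structure IsElementSolution (p : ℕ) (z : ℂ) (u : ℂ[X]) : Prop where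
  natDegree_le : u.natDegree ≤ p
  orthogonal : ∀ g : ℂ[X], g.natDegree ≤ p → g.eval 0 = 0 → g.eval 1 = 0 → complexForm z u g = 0

lemma IsElementSolution.add {p : ℕ} {z : ℂ} {u v : ℂ[X]} (hu : IsElementSolution p z u)
    (hv : IsElementSolution p z v) : IsElementSolution p z (u + v) where
  natDegree_le := natDegree_add_le_of_degree_le hu.1 hv.1
  orthogonal g hg h0 h1 := by
    rw [map_add, LinearMap.add_apply, hu.2 g hg h0 h1, hv.2 g hg h0 h1, add_zero]

lemma IsElementSolution.smul {p : ℕ} {z : ℂ} {u : ℂ[X]} (c : ℂ) (hu : IsElementSolution p z u) :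
    IsElementSolution p z (c • u) where
  natDegree_le := (natDegree_smul_le c u).trans hu.1
  orthogonal g hg h0 h1 := by
    rw [map_smul, LinearMap.smul_apply, hu.2 g hg h0 h1, smul_zero]

lemma natDegree_vertex_le {p : ℕ} (hp : 1 ≤ p) (i : Fin 2) : (vertex i).natDegree ≤ p := by
  refine le_trans ?_ hp
  fin_cases i
  · exact natDegree_one_sub_X_le
  · simp [vertex]

/-- Testing against an element solution only sees the vertex values of the test function. -/
lemma IsElementSolution.form_eq {p : ℕ} (hp : 1 ≤ p) {z : ℂ} {u : ℂ[X]}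
    (hu : IsElementSolution p z u) {g : ℂ[X]} (hg : g.natDegree ≤ p) :
    complexForm z u g
      = g.eval 0 * complexForm z u (1 - X) + g.eval 1 * complexForm z u X := by
  have h0 : (1 - X : ℂ[X]).natDegree ≤ p := natDegree_vertex_le hp 0
  have h1 : (X : ℂ[X]).natDegree ≤ p := natDegree_vertex_le hp 1
  -- Subtracting the linear interpolant of `g` leaves a function vanishing at both vertices, which
  -- `u` does not see.
  have h := hu.2 (g - (g.eval 0 • (1 - X) + g.eval 1 • X))
    ((natDegree_sub_le _ _).trans (max_le hg (natDegree_add_le_of_degree_le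
      ((natDegree_smul_le _ _).trans h0) ((natDegree_smul_le _ _).trans h1))))
    (by simp) (by simp)
  rw [map_sub, map_add, map_smul, map_smul, smul_eq_mul, smul_eq_mul] at h
  linear_combination h

/-- The interior block of the element matrix. -/
def interiorMatrix (p : ℕ) (z : ℂ) : Matrix (Fin (p - 1)) (Fin (p - 1)) ℂ :=
  Matrix.of fun i j => complexForm z (bubble i) (bubble j)

lemma condensedMatrix_apply (p : ℕ) (z : ℂ) (i j : Fin 2) :
    condensedMatrix p z i j = complexForm z (vertex i) (vertex j)
      - ((Matrix.of fun (i : Fin 2) (l : Fin (p - 1)) => complexForm z (vertex i) (bubble l))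
        * (interiorMatrix p z)⁻¹
        * Matrix.of fun (l : Fin (p - 1)) (j : Fin 2) =>
            complexForm z (bubble l) (vertex j)) i j := by
  simp only [condensedMatrix, elementForm_eq_complexForm, map_bubbleShape, map_vertexShape]
  rfl

/-- The Schur complement evaluates the element form on element solutions. -/
lemma condensedMatrix_eq_form {p : ℕ} (hp : 1 ≤ p) {z : ℂ} (hA : (interiorMatrix p z).det ≠ 0)
    (u : Fin 2 → ℂ[X]) (hu : ∀ i, IsElementSolution p z (u i))
    (h0 : ∀ i, (u i).eval 0 = (vertex i).eval 0) (h1 : ∀ i, (u i).eval 1 = (vertex i).eval 1)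
    (i j : Fin 2) :
    condensedMatrix p z i j = complexForm z (u i) (vertex j) := by
  have hex : ∀ i, ∃ c : Fin (p - 1) → ℂ, u i - vertex i = ∑ l, c l • bubble l := fun i =>
    exists_bubble_expansion
      ((natDegree_sub_le _ _).trans (max_le (hu i).1 (natDegree_vertex_le hp i)))
      (by simp [h0 i]) (by simp [h1 i])
  choose c hc using hex
  have hu' : ∀ i, u i = vertex i + ∑ l, c i l • bubble l := fun i => by rw [← hc i]; ring
  -- Orthogonality to the bubbles says that the coupling block is `-c A`, with `A` the interior
  -- block, so `A⁻¹` cancels and the Schur complement needs no explicit inverse.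
  have hB : (Matrix.of fun (i : Fin 2) (l : Fin (p - 1)) => complexForm z (vertex i) (bubble l))
      = -(Matrix.of c * interiorMatrix p z) := by
    ext a m
    have h := (hu a).2 (bubble m) (natDegree_bubble_le m) (bubble_eval_zero m) (bubble_eval_one m)
    rw [hu' a, map_add, LinearMap.add_apply, map_sum, LinearMap.sum_apply] at h
    simp only [map_smul, LinearMap.smul_apply, smul_eq_mul] at h
    simp only [Matrix.of_apply, Matrix.neg_apply, Matrix.mul_apply, interiorMatrix]
    linear_combination h
  rw [condensedMatrix_apply, hB, Matrix.neg_mul, Matrix.mul_nonsing_inv_cancel_right _ _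
    (isUnit_iff_ne_zero.2 hA), hu' i, map_add, LinearMap.add_apply, map_sum, LinearMap.sum_apply]
  simp only [map_smul, LinearMap.smul_apply, smul_eq_mul, Matrix.neg_apply,
    Matrix.mul_apply, Matrix.of_apply, neg_mul, Finset.sum_neg_distrib, sub_neg_eq_add]

/-- At `z = 0` this is the Gram matrix of the bubbles for `∫ f' g'`. A kernel vector gives a
combination of bubbles with zero derivative; it vanishes at `0`, hence everywhere, and the bubbles
are independent. -/
lemma interiorMatrix_zero_det_ne_zero (p : ℕ) : (interiorMatrix p 0).det ≠ 0 := by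
  let G : Matrix (Fin (p - 1)) (Fin (p - 1)) ℝ := Matrix.of fun i j =>
    ∫ x in (0 : ℝ)..1, (bubbleShape p i).derivative.eval x * (bubbleShape p j).derivative.eval x
  have hG : interiorMatrix p 0 = G.map (algebraMap ℝ ℂ) := by
    ext i j
    simp only [interiorMatrix, Matrix.of_apply, Matrix.map_apply, G]
    rw [← map_bubbleShape, ← map_bubbleShape, ← elementForm_eq_complexForm]
    simp [elementForm]
  rw [hG, ← RingHom.mapMatrix_apply, ← RingHom.map_det]
  refine (_root_.map_ne_zero _).2 fun hdet => ?_
  obtain ⟨v, hv, hGv⟩ := Matrix.exists_mulVec_eq_zero_iff.2 hdet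
  set f : ℝ[X] := ∑ i, v i • bubbleShape p i with hf
  have hint : ∫ x in (0 : ℝ)..1, f.derivative.eval x * f.derivative.eval x = 0 := by
    have hpt : ∀ x : ℝ, f.derivative.eval x * f.derivative.eval x = ∑ i, ∑ j, v i *
        ((bubbleShape p i).derivative.eval x * (bubbleShape p j).derivative.eval x * v j) := by
      intro x
      simp only [hf, derivative_sum, derivative_smul, eval_finsetSum, eval_smul, smul_eq_mul,
        Finset.sum_mul_sum]
      exact Finset.sum_congr rfl fun i _ => Finset.sum_congr rfl fun j _ => by ring
    have h : v ⬝ᵥ G.mulVec v = 0 := by rw [hGv]; simp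
    refine Eq.trans ?_ h
    simp only [hpt, dotProduct, Matrix.mulVec, G, Matrix.of_apply, Finset.mul_sum]
    rw [intervalIntegral.integral_finsetSum fun i _ =>
      Continuous.intervalIntegrable (by fun_prop) _ _]
    refine Finset.sum_congr rfl fun i _ => ?_
    rw [intervalIntegral.integral_finsetSum fun j _ =>
      Continuous.intervalIntegrable (by fun_prop) _ _]
    refine Finset.sum_congr rfl fun j _ => ?_
    rw [intervalIntegral.integral_const_mul, intervalIntegral.integral_mul_const]
  have hderiv : f.derivative = 0 := by
    by_contra hne
    have hpos : 0 < ∫ x in (0 : ℝ)..1, f.derivative.eval x * f.derivative.eval x := by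
      obtain ⟨a, ha, hroot⟩ : ∃ a ∈ Set.Ioo (0 : ℝ) 1, ¬ f.derivative.IsRoot a := by
        by_contra hall
        push Not at hall
        exact hne (eq_zero_of_infinite_isRoot _
          ((Set.Ioo_infinite (zero_lt_one' ℝ)).mono fun a ha => hall a ha))
      refine intervalIntegral.integral_pos zero_lt_one
        (Continuous.continuousOn (by fun_prop)) (fun x _ => mul_self_nonneg _)
        ⟨a, ⟨ha.1.le, ha.2.le⟩, mul_self_pos.2 hroot⟩
    exact hpos.ne' hint
  have hf0 : f = 0 := by
    have h := derivative_eq_zero.1 hderiv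
    rw [eq_C_of_natDegree_eq_zero h, coeff_zero_eq_eval_zero, hf]
    simp [eval_finsetSum, bubbleShape]
  have hfac : X * (1 - X) * ∑ i : Fin (p - 1), C (v i) * X ^ (i : ℕ) = (0 : ℝ[X]) := by
    rw [← hf0, hf, Finset.mul_sum]
    exact Finset.sum_congr rfl fun i _ => by rw [smul_eq_C_mul, bubbleShape]; ring
  have hX1 : (1 - X : ℝ[X]) ≠ 0 := fun h => by simpa using congrArg (eval 0) h
  have hsum := (mul_eq_zero.1 hfac).resolve_left (mul_ne_zero X_ne_zero hX1)
  refine hv (funext fun i => ?_)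
  have := congrArg (fun q => coeff q (i : ℕ)) hsum
  simpa [finsetSum_coeff, coeff_C_mul_X_pow, Fin.val_inj, coeff_X_pow] using this

/-- For small `z` the `⁻¹` in `condensedMatrix` is therefore a genuine inverse and not the default
value of a singular matrix. -/
lemma eventually_interiorMatrix_det_ne_zero (p : ℕ) :
    ∀ᶠ z in nhds (0 : ℂ), (interiorMatrix p z).det ≠ 0 := by
  have hc : Continuous fun z => (interiorMatrix p z).det := by
    refine Continuous.matrix_det ?_
    refine continuous_matrix fun i j => ?_
    simp only [interiorMatrix, Matrix.of_apply, complexForm_apply]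
    fun_prop
  exact hc.continuousAt.eventually_ne (interiorMatrix_zero_det_ne_zero p)

/-! ### Legendre polynomials through Rodrigues' formula -/

/-- The polynomial `(x (1 - x))^q`, whose `q`-th derivative is a multiple of the Legendre polynomial
of degree `q` on `[0, 1]`. -/
def rodrigues (q : ℕ) : ℂ[X] := (X * (1 - X)) ^ q

lemma natDegree_X_mul_one_sub_X : (X * (1 - X) : ℂ[X]).natDegree = 2 := by
  rw [show (X * (1 - X) : ℂ[X]) = -(X ^ 2 - X) by ring, natDegree_neg]
  compute_degree!

lemma leadingCoeff_X_mul_one_sub_X : (X * (1 - X) : ℂ[X]).leadingCoeff = -1 := by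
  rw [leadingCoeff, natDegree_X_mul_one_sub_X, show (X * (1 - X) : ℂ[X]) = X - X ^ 2 by ring]
  simp [coeff_X]

lemma natDegree_rodrigues (q : ℕ) : (rodrigues q).natDegree = 2 * q := by
  rw [rodrigues, natDegree_pow, natDegree_X_mul_one_sub_X, mul_comm]

lemma iterate_derivative_rodrigues (q : ℕ) :
    derivative^[2 * q] (rodrigues q) = C ((-1) ^ q * ((2 * q).factorial : ℂ)) := by
  have hd : (derivative^[2 * q] (rodrigues q)).natDegree = 0 := by
    have := natDegree_iterate_derivative (rodrigues q) (2 * q)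
    rw [natDegree_rodrigues] at this
    omega
  have hl : (rodrigues q).coeff (2 * q) = (-1) ^ q := by
    rw [← natDegree_rodrigues, coeff_natDegree, rodrigues, leadingCoeff_pow,
      leadingCoeff_X_mul_one_sub_X]
  rw [eq_C_of_natDegree_eq_zero hd, coeff_iterate_derivative, zero_add, hl,
    Nat.descFactorial_self, nsmul_eq_mul, mul_comm]

lemma rodrigues_comp (q : ℕ) : (rodrigues q).comp (1 - X) = rodrigues q := by
  simp only [rodrigues, pow_comp, mul_comp, sub_comp, one_comp, X_comp]
  ring

/-- The reflection `x ↦ 1 - x` fixes `(x (1 - x))^q`, and each derivative contributes a sign. All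
parity statements below come from here. -/
lemma eval_zero_iterate_derivative_rodrigues (q m : ℕ) :
    (derivative^[m] (rodrigues q)).eval 0 = (-1) ^ m * (derivative^[m] (rodrigues q)).eval 1 := by
  conv_lhs => rw [← rodrigues_comp, iterate_derivative_comp_one_sub_X]
  have h1 : ((-1 : ℂ[X]) ^ m).eval 0 = (-1) ^ m := by simp
  rw [eval_mul, h1]
  simp [eval_comp]

lemma eval_one_iterate_derivative_rodrigues {q m : ℕ} (h : m < q) :
    (derivative^[m] (rodrigues q)).eval 1 = 0 := by
  obtain ⟨r, hr⟩ := pow_sub_dvd_iterate_derivative_pow (X * (1 - X) : ℂ[X]) q m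
  rw [rodrigues, hr]
  simp [(Nat.sub_pos_of_lt h).ne']

/-- Repeated integration by parts: `(x (1 - x))^q` vanishes to order `q` at both ends, so no
boundary term appears. -/
lemma polyIntegral_iterate_derivative_rodrigues_mul {q k : ℕ} (hk : k ≤ q) (g : ℂ[X]) :
    polyIntegral (derivative^[k] (rodrigues q) * g)
      = (-1) ^ k * polyIntegral (rodrigues q * derivative^[k] g) := by
  induction k generalizing g with
  | zero => simp
  | succ k ih =>
    rw [Function.iterate_succ_apply', polyIntegral_derivative_mul,
      eval_zero_iterate_derivative_rodrigues, eval_one_iterate_derivative_rodrigues hk,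
      ih (by omega), Function.iterate_succ_apply]
    ring

/-- The Legendre polynomial is orthogonal to all polynomials of lower degree. -/
lemma polyIntegral_legendre_mul {q : ℕ} {g : ℂ[X]} (hg : g.natDegree < q) :
    polyIntegral (derivative^[q] (rodrigues q) * g) = 0 := by
  rw [polyIntegral_iterate_derivative_rodrigues_mul le_rfl, iterate_derivative_eq_zero hg]
  simp

/-! ### Explicit polynomial element solutions -/

/-- The polynomial solution `u` of `u'' + z² u = z^(2m+2) g`, where `g` is the `(q+1)`-st derivative
of `(x (1 - x))^q` and `q ≤ 2m+2`. -/
def elementSolution (q m : ℕ) (z : ℂ) : ℂ[X] :=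
  ∑ k ∈ Finset.range (m + 1),
    ((-1) ^ k * z ^ (2 * (m - k))) • derivative^[q + 1 + 2 * k] (rodrigues q)

lemma natDegree_elementSolution_le (q m : ℕ) (z : ℂ) :
    (elementSolution q m z).natDegree ≤ q - 1 := by
  refine natDegree_sum_le_of_forall_le _ _ fun k _ => (natDegree_smul_le _ _).trans ?_
  refine (natDegree_iterate_derivative _ _).trans ?_
  rw [natDegree_rodrigues]
  omega

/-- The two derivatives of the `k`-th summand cancel `z²` times the next one, so the sum telescopes.
The last term has `q + 2m + 3` derivatives on a polynomial of degree `2q`, which is zero precisely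
because `q ≤ 2m + 2`. -/
lemma elementSolution_ode {q m : ℕ} (h : q ≤ 2 * m + 2) (z : ℂ) :
    derivative (derivative (elementSolution q m z)) + C (z ^ 2) * elementSolution q m z
      = z ^ (2 * m + 2) • derivative^[q + 1] (rodrigues q) := by
  set F : ℕ → ℂ[X] := fun k =>
    ((-1) ^ k * z ^ (2 * (m + 1 - k))) • derivative^[q + 1 + 2 * k] (rodrigues q) with hF
  have hsum : derivative (derivative (elementSolution q m z))
      + C (z ^ 2) * elementSolution q m z = ∑ k ∈ Finset.range (m + 1), (F k - F (k + 1)) := by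
    rw [elementSolution, derivative_sum, derivative_sum, Finset.mul_sum, ← Finset.sum_add_distrib]
    refine Finset.sum_congr rfl fun k hk => ?_
    have hk' : k ≤ m := Nat.lt_succ_iff.1 (Finset.mem_range.1 hk)
    have e1 : 2 * (m + 1 - k) = 2 * (m - k) + 2 := by omega
    have e2 : 2 * (m + 1 - (k + 1)) = 2 * (m - k) := by omega
    have e3 : q + 1 + 2 * (k + 1) = q + 1 + 2 * k + 1 + 1 := by ring
    simp only [hF, e1, e2, e3, derivative_smul, Function.iterate_succ_apply']
    simp only [smul_eq_C_mul, map_mul, map_pow, map_neg, map_one, pow_succ]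
    ring
  rw [hsum, Finset.sum_range_sub']
  have h0 : F (m + 1) = 0 := by
    simp only [hF]
    rw [iterate_derivative_eq_zero (by rw [natDegree_rodrigues]; omega), smul_zero]
  rw [h0, sub_zero]
  simp [hF, mul_add]

lemma eval_zero_elementSolution (q m : ℕ) (z : ℂ) :
    (elementSolution q m z).eval 0 = (-1) ^ (q + 1) * (elementSolution q m z).eval 1 := by
  simp only [elementSolution, eval_finsetSum, eval_smul, Finset.mul_sum,
    eval_zero_iterate_derivative_rodrigues q, smul_eq_mul]
  refine Finset.sum_congr rfl fun k _ => ?_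
  rw [pow_add _ (q + 1) (2 * k), pow_mul (-1 : ℂ), neg_one_sq, one_pow]
  ring

lemma eval_zero_derivative_elementSolution (q m : ℕ) (z : ℂ) :
    (derivative (elementSolution q m z)).eval 0
      = (-1) ^ q * (derivative (elementSolution q m z)).eval 1 := by
  simp only [elementSolution, derivative_sum, derivative_smul, ← Function.iterate_succ_apply',
    eval_finsetSum, eval_smul, Finset.mul_sum,
    eval_zero_iterate_derivative_rodrigues q, smul_eq_mul]
  refine Finset.sum_congr rfl fun k _ => ?_
  rw [show (q + 1 + 2 * k).succ = q + 2 * (k + 1) by grind, pow_add _ q,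
    pow_mul (-1 : ℂ), neg_one_sq, one_pow]
  ring

/-- The residual is a multiple of `L_q'`; after integration by parts `L_q` meets `g'`, of degree
below `q`, and only boundary terms survive. Parity combines them into one factor, the flux. -/
lemma complexForm_elementSolution {q m : ℕ} (h : q ≤ 2 * m + 2) (hq : 1 ≤ q) (z : ℂ) {g : ℂ[X]}
    (hg : g.natDegree ≤ q) :
    complexForm z (elementSolution q m z) g
      = ((derivative (elementSolution q m z)).eval 1
          - z ^ (2 * m + 2) * (derivative^[q] (rodrigues q)).eval 1)
        * (g.eval 1 - (-1) ^ q * g.eval 0) := by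
  have hg' : (derivative g).natDegree < q := by
    have := natDegree_derivative_le g
    omega
  rw [complexForm_eq_boundary, elementSolution_ode h, smul_mul_assoc, map_smul, smul_eq_mul,
    Function.iterate_succ_apply', polyIntegral_derivative_mul, polyIntegral_legendre_mul hg',
    eval_zero_derivative_elementSolution, eval_zero_iterate_derivative_rodrigues]
  ring

/-- `p ≤ q` admits all required test functions, while `q ≤ p + 1` keeps the degree `q - 1` of the
solution within `p`. -/
lemma isElementSolution_elementSolution {p q m : ℕ} (h : q ≤ 2 * m + 2) (hq : 1 ≤ q)
    (hpq : p ≤ q) (hqp : q ≤ p + 1) (z : ℂ) : IsElementSolution p z (elementSolution q m z) where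
  natDegree_le := (natDegree_elementSolution_le q m z).trans (by omega)
  orthogonal g hg h0 h1 := by
    rw [complexForm_elementSolution h hq z (hg.trans hpq), h0, h1]
    ring

/-- The flux of `elementSolution` seen by the vertex function `x`. -/
def solutionFlux (q m : ℕ) (z : ℂ) : ℂ :=
  (derivative (elementSolution q m z)).eval 1
    - z ^ (2 * m + 2) * (derivative^[q] (rodrigues q)).eval 1

/-! ### Comparison with the exact trigonometric solutions -/

/-- The functional `f ↦ ∫₀¹ f(x) cos (z (x - 1/2))`. -/
def cosIntegral (z : ℂ) : ℂ[X] →ₗ[ℂ] ℂ where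
  toFun f := ∫ x in (0 : ℝ)..1, f.eval (x : ℂ) * Complex.cos (z * (x - 1 / 2))
  map_add' f g := by
    simp only [eval_add, add_mul]
    exact intervalIntegral.integral_add
      (Continuous.intervalIntegrable (by fun_prop) _ _)
      (Continuous.intervalIntegrable (by fun_prop) _ _)
  map_smul' c f := by
    simp only [eval_smul, smul_eq_mul, RingHom.id_apply, mul_assoc]
    exact intervalIntegral.integral_const_mul _ _

/-- The functional `f ↦ ∫₀¹ f(x) sin (z (x - 1/2))`. -/
def sinIntegral (z : ℂ) : ℂ[X] →ₗ[ℂ] ℂ where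
  toFun f := ∫ x in (0 : ℝ)..1, f.eval (x : ℂ) * Complex.sin (z * (x - 1 / 2))
  map_add' f g := by
    simp only [eval_add, add_mul]
    exact intervalIntegral.integral_add
      (Continuous.intervalIntegrable (by fun_prop) _ _)
      (Continuous.intervalIntegrable (by fun_prop) _ _)
  map_smul' c f := by
    simp only [eval_smul, smul_eq_mul, RingHom.id_apply, mul_assoc]
    exact intervalIntegral.integral_const_mul _ _

lemma cosIntegral_apply (z : ℂ) (f : ℂ[X]) : cosIntegral z f
    = ∫ x in (0 : ℝ)..1, f.eval (x : ℂ) * Complex.cos (z * (x - 1 / 2)) := rfl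

lemma sinIntegral_apply (z : ℂ) (f : ℂ[X]) : sinIntegral z f
    = ∫ x in (0 : ℝ)..1, f.eval (x : ℂ) * Complex.sin (z * (x - 1 / 2)) := rfl

lemma hasDerivAt_centered (z x : ℂ) : HasDerivAt (fun t : ℂ => z * (t - 1 / 2)) z x := by
  simpa using ((hasDerivAt_id x).sub_const (1 / 2 : ℂ)).const_mul z

lemma cosIntegral_derivative (z : ℂ) (f : ℂ[X]) :
    cosIntegral z (derivative f)
      = (f.eval 1 - f.eval 0) * Complex.cos (z / 2) + z * sinIntegral z f := by
  have h := intervalIntegral.integral_deriv_mul_eq_sub (a := (0 : ℝ)) (b := 1)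
    (fun x _ => hasDerivAt_eval_ofReal f x) (fun x _ => (hasDerivAt_centered z x).ccos.comp_ofReal)
    (Continuous.intervalIntegrable (by fun_prop) _ _)
    (Continuous.intervalIntegrable (by fun_prop) _ _)
  rw [intervalIntegral.integral_add (Continuous.intervalIntegrable (by fun_prop) _ _)
    (Continuous.intervalIntegrable (by fun_prop) _ _), ← cosIntegral_apply] at h
  have h2 : ∫ x in (0 : ℝ)..1, f.eval (x : ℂ) * (-Complex.sin (z * (x - 1 / 2)) * z)
      = -z * sinIntegral z f := by
    rw [sinIntegral_apply, ← intervalIntegral.integral_const_mul]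
    exact intervalIntegral.integral_congr fun x _ => by ring
  rw [h2] at h
  have e1 : z * (((1 : ℝ) : ℂ) - 1 / 2) = z / 2 := by push_cast; ring
  have e0 : z * (((0 : ℝ) : ℂ) - 1 / 2) = -(z / 2) := by push_cast; ring
  rw [e1, e0, Complex.cos_neg] at h
  push_cast at h
  linear_combination h

lemma sinIntegral_derivative (z : ℂ) (f : ℂ[X]) :
    sinIntegral z (derivative f)
      = (f.eval 1 + f.eval 0) * Complex.sin (z / 2) - z * cosIntegral z f := by
  have h := intervalIntegral.integral_deriv_mul_eq_sub (a := (0 : ℝ)) (b := 1)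
    (fun x _ => hasDerivAt_eval_ofReal f x) (fun x _ => (hasDerivAt_centered z x).csin.comp_ofReal)
    (Continuous.intervalIntegrable (by fun_prop) _ _)
    (Continuous.intervalIntegrable (by fun_prop) _ _)
  rw [intervalIntegral.integral_add (Continuous.intervalIntegrable (by fun_prop) _ _)
    (Continuous.intervalIntegrable (by fun_prop) _ _), ← sinIntegral_apply] at h
  have h2 : ∫ x in (0 : ℝ)..1, f.eval (x : ℂ) * (Complex.cos (z * (x - 1 / 2)) * z)
      = z * cosIntegral z f := by
    rw [cosIntegral_apply, ← intervalIntegral.integral_const_mul]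
    exact intervalIntegral.integral_congr fun x _ => by ring
  rw [h2] at h
  have e1 : z * (((1 : ℝ) : ℂ) - 1 / 2) = z / 2 := by push_cast; ring
  have e0 : z * (((0 : ℝ) : ℂ) - 1 / 2) = -(z / 2) := by push_cast; ring
  rw [e1, e0, Complex.sin_neg] at h
  push_cast at h
  linear_combination h

/-- Each pair of derivatives moved onto the cosine yields `-z²`; the boundary terms involve
derivatives of order below `q` and vanish. -/
lemma cosIntegral_iterate_derivative_rodrigues {q j : ℕ} (h : 2 * j ≤ q) (z : ℂ) :
    cosIntegral z (derivative^[2 * j] (rodrigues q))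
      = (-z ^ 2) ^ j * cosIntegral z (rodrigues q) := by
  induction j with
  | zero => simp
  | succ j ih =>
    rw [mul_add, mul_one, Function.iterate_succ_apply', cosIntegral_derivative,
      Function.iterate_succ_apply', sinIntegral_derivative, ih (by omega),
      ← Function.iterate_succ_apply' derivative]
    simp only [eval_zero_iterate_derivative_rodrigues,
      eval_one_iterate_derivative_rodrigues (show 2 * j < q by omega),
      eval_one_iterate_derivative_rodrigues (show 2 * j + 1 < q by omega)]
    ring

/-- The discrete counterpart of `w'(1) = -z tan (z/2) w(1)` for even solutions. -/
lemma solutionFlux_odd (m : ℕ) (z : ℂ) :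
    solutionFlux (2 * m + 1) m z * Complex.cos (z / 2)
        + z * (elementSolution (2 * m + 1) m z).eval 1 * Complex.sin (z / 2)
      = z ^ (2 * m + 2) * (-z ^ 2) ^ (m + 1) / 2 * cosIntegral z (rodrigues (2 * m + 1)) := by
  -- The cosine is annihilated by `∂² + z²`, so the left side reduces to boundary terms. On the
  -- right, the first integration by parts supplies the boundary term of `solutionFlux`, and the
  -- remaining ones produce powers of `z`.
  have h := congrArg (cosIntegral z)
    (elementSolution_ode (show 2 * m + 1 ≤ 2 * m + 2 by omega) z)
  rw [map_add, ← smul_eq_C_mul, map_smul, map_smul, smul_eq_mul, smul_eq_mul,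
    cosIntegral_derivative, sinIntegral_derivative,
    Function.iterate_succ_apply' _ (2 * m + 1), cosIntegral_derivative,
    Function.iterate_succ_apply' _ (2 * m), sinIntegral_derivative,
    cosIntegral_iterate_derivative_rodrigues (by omega),
    ← Function.iterate_succ_apply' derivative (2 * m),
    eval_zero_elementSolution, eval_zero_derivative_elementSolution,
    eval_zero_iterate_derivative_rodrigues, eval_zero_iterate_derivative_rodrigues,
    eval_one_iterate_derivative_rodrigues (show 2 * m < 2 * m + 1 by omega)] at h
  have e1 : (-1 : ℂ) ^ (2 * m + 1) = -1 := Odd.neg_one_pow ⟨m, rfl⟩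
  have e2 : (-1 : ℂ) ^ (2 * m + 1 + 1) = 1 := by rw [pow_succ, e1]; norm_num
  rw [e1, e2] at h
  rw [solutionFlux]
  linear_combination h / 2

/-- The discrete counterpart of `w'(1) = z cot (z/2) w(1)` for odd solutions. -/
lemma solutionFlux_even (m : ℕ) (z : ℂ) :
    solutionFlux (2 * m + 2) m z * Complex.sin (z / 2)
        - z * (elementSolution (2 * m + 2) m z).eval 1 * Complex.cos (z / 2)
      = -(z ^ (2 * m + 3) * (-z ^ 2) ^ (m + 1) / 2
          * cosIntegral z (rodrigues (2 * m + 2))) := by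
  have h := congrArg (sinIntegral z) (elementSolution_ode (le_refl (2 * m + 2)) z)
  rw [map_add, ← smul_eq_C_mul, map_smul, map_smul, smul_eq_mul, smul_eq_mul,
    sinIntegral_derivative, cosIntegral_derivative,
    Function.iterate_succ_apply' _ (2 * m + 2), sinIntegral_derivative,
    show 2 * m + 2 = 2 * (m + 1) by ring,
    cosIntegral_iterate_derivative_rodrigues le_rfl,
    eval_zero_elementSolution, eval_zero_derivative_elementSolution,
    eval_zero_iterate_derivative_rodrigues] at h
  have e1 : (-1 : ℂ) ^ (2 * (m + 1)) = 1 := by simp [pow_mul]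
  have e2 : (-1 : ℂ) ^ (2 * (m + 1) + 1) = -1 := by rw [pow_succ, e1]; norm_num
  rw [e1, e2] at h
  rw [solutionFlux, show 2 * m + 2 = 2 * (m + 1) by ring]
  linear_combination h / 2

/-! ### Element solutions at `z = 0` -/

lemma elementSolution_at_zero (q m : ℕ) :
    elementSolution q m 0 = (-1 : ℂ) ^ m • derivative^[q + 1 + 2 * m] (rodrigues q) := by
  rw [elementSolution, Finset.sum_eq_single m]
  · simp
  · intro k hk hkm
    have : 2 * (m - k) ≠ 0 := by
      have := Finset.mem_range.1 hk
      omega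
    simp [this]
  · simp

lemma eval_one_elementSolution_odd_zero (m : ℕ) :
    (elementSolution (2 * m + 1) m 0).eval 1
      = (-1) ^ (m + 1) * ((2 * (2 * m + 1)).factorial : ℂ) := by
  rw [elementSolution_at_zero, show 2 * m + 1 + 1 + 2 * m = 2 * (2 * m + 1) by ring,
    iterate_derivative_rodrigues, eval_smul, eval_C, Odd.neg_one_pow ⟨m, rfl⟩, smul_eq_mul]
  ring

lemma eval_one_derivative_elementSolution_even_zero (m : ℕ) :
    (derivative (elementSolution (2 * m + 2) m 0)).eval 1
      = (-1) ^ m * ((2 * (2 * m + 2)).factorial : ℂ) := by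
  rw [elementSolution_at_zero, derivative_smul, ← Function.iterate_succ_apply' derivative,
    show (2 * m + 2 + 1 + 2 * m).succ = 2 * (2 * m + 2) by grind, iterate_derivative_rodrigues,
    eval_smul, eval_C, Even.neg_one_pow (n := 2 * m + 2) ⟨m + 1, by ring⟩, smul_eq_mul, one_mul]

/-- At `z = 0` the solution is linear and odd about the midpoint, so its value at `1` is half its
slope. -/
lemma eval_one_elementSolution_even_zero (m : ℕ) :
    (elementSolution (2 * m + 2) m 0).eval 1
      = (-1) ^ m * ((2 * (2 * m + 2)).factorial : ℂ) / 2 := by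
  have hI := polyIntegral_derivative (elementSolution (2 * m + 2) m 0)
  have hd : derivative (elementSolution (2 * m + 2) m 0)
      = C ((-1) ^ m * ((2 * (2 * m + 2)).factorial : ℂ)) := by
    rw [elementSolution_at_zero, derivative_smul, ← Function.iterate_succ_apply' derivative,
      show (2 * m + 2 + 1 + 2 * m).succ = 2 * (2 * m + 2) by grind, iterate_derivative_rodrigues,
      Even.neg_one_pow (n := 2 * m + 2) ⟨m + 1, by ring⟩, one_mul, smul_C, smul_eq_mul]
  rw [hd, eval_zero_elementSolution, show 2 * m + 2 + 1 = 2 * (m + 1) + 1 by ring,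
    Odd.neg_one_pow ⟨m + 1, rfl⟩] at hI
  have hc : ∀ a : ℂ, polyIntegral (C a) = a := fun a => by simp [polyIntegral_apply]
  rw [hc] at hI
  linear_combination -hI / 2

/-! ### Limits with quadratic remainder -/

/-- `f z = c + O(z²)` as `z → 0`, including the value `f 0 = c`. -/
def HasQuadraticLimit (f : ℂ → ℂ) (c : ℂ) : Prop :=
  (fun z => f z - c) =O[𝓝 0] fun z : ℂ => z ^ 2

namespace HasQuadraticLimit

variable {f g : ℂ → ℂ} {a b : ℂ}

lemma const (a : ℂ) : HasQuadraticLimit (fun _ => a) a := by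
  simpa [HasQuadraticLimit] using isBigO_zero _ _

lemma sq : HasQuadraticLimit (fun z => z ^ 2) 0 := by
  simpa [HasQuadraticLimit] using isBigO_refl _ _

lemma tendsto (hf : HasQuadraticLimit f a) : Tendsto f (𝓝 0) (𝓝 a) := by
  have h : Tendsto (fun z : ℂ => z ^ 2) (𝓝 0) (𝓝 0) :=
    (continuous_pow 2).tendsto' _ _ (by simp)
  simpa using (IsBigO.trans_tendsto hf h).add_const a

lemma add (hf : HasQuadraticLimit f a) (hg : HasQuadraticLimit g b) :
    HasQuadraticLimit (fun z => f z + g z) (a + b) :=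
  (IsBigO.add hf hg).congr_left fun z => by ring

lemma mul (hf : HasQuadraticLimit f a) (hg : HasQuadraticLimit g b) :
    HasQuadraticLimit (fun z => f z * g z) (a * b) := by
  have h1 : (fun z => (f z - a) * g z) =O[𝓝 0] fun z : ℂ => z ^ 2 * 1 :=
    IsBigO.mul hf (hg.tendsto.isBigO_one ℂ)
  have h2 : (fun z => a * (g z - b)) =O[𝓝 0] fun z : ℂ => z ^ 2 := IsBigO.const_mul_left hg a
  simp only [mul_one] at h1
  exact (h1.add h2).congr_left fun z => by ring

lemma const_mul (c : ℂ) (hf : HasQuadraticLimit f a) :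
    HasQuadraticLimit (fun z => c * f z) (c * a) := (const c).mul hf

lemma sub (hf : HasQuadraticLimit f a) (hg : HasQuadraticLimit g b) :
    HasQuadraticLimit (fun z => f z - g z) (a - b) :=
  (IsBigO.sub hf hg).congr_left fun z => by ring

lemma sum {ι : Type*} (s : Finset ι) {F : ι → ℂ → ℂ} {c : ι → ℂ}
    (h : ∀ i ∈ s, HasQuadraticLimit (F i) (c i)) :
    HasQuadraticLimit (fun z => ∑ i ∈ s, F i z) (∑ i ∈ s, c i) :=
  (IsBigO.sum h).congr_left fun z => by simp [Finset.sum_sub_distrib]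

lemma pow (hf : HasQuadraticLimit f a) (n : ℕ) :
    HasQuadraticLimit (fun z => f z ^ n) (a ^ n) := by
  induction n with
  | zero => simpa using const 1
  | succ n ih => simpa only [pow_succ] using ih.mul hf

lemma inv (hf : HasQuadraticLimit f a) (ha : a ≠ 0) :
    HasQuadraticLimit (fun z => (f z)⁻¹) a⁻¹ := by
  have h1 : (fun z => (f z - a) * (-(f z)⁻¹ * a⁻¹)) =O[𝓝 0] fun z : ℂ => z ^ 2 * 1 :=
    IsBigO.mul hf (((hf.tendsto.inv₀ ha).neg.mul_const a⁻¹).isBigO_one ℂ)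
  simp only [mul_one] at h1
  refine h1.congr' ?_ EventuallyEq.rfl
  filter_upwards [hf.tendsto.eventually_ne ha] with z hz
  field_simp
  ring

lemma div (hf : HasQuadraticLimit f a) (hg : HasQuadraticLimit g b) (hb : b ≠ 0) :
    HasQuadraticLimit (fun z => f z / g z) (a / b) := by
  simpa only [div_eq_mul_inv] using hf.mul (hg.inv hb)

end HasQuadraticLimit

lemma norm_cos_sub_one_le {y : ℂ} (hy : ‖y‖ ≤ 1) : ‖Complex.cos y - 1‖ ≤ ‖y‖ ^ 2 := by
  have h := Complex.cos_bound hy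
  have h1 : ‖Complex.cos y - 1‖ ≤ ‖Complex.cos y - (1 - y ^ 2 / 2)‖ + ‖y ^ 2 / 2‖ := by
    refine (norm_sub_le _ _).trans' (le_of_eq ?_)
    congr 1
    ring
  have h2 : ‖y ^ 2 / 2‖ = ‖y‖ ^ 2 / 2 := by simp
  have h3 : ‖y‖ ^ 4 ≤ ‖y‖ ^ 2 := pow_le_pow_of_le_one (norm_nonneg _) hy (by norm_num)
  nlinarith [sq_nonneg ‖y‖]

lemma hasQuadraticLimit_cos_half : HasQuadraticLimit (fun z => Complex.cos (z / 2)) 1 := by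
  refine IsBigO.of_bound 1 ?_
  filter_upwards [Metric.ball_mem_nhds (0 : ℂ) one_pos] with z hz
  have hz' : ‖z‖ < 1 := by simpa using hz
  have h2 : ‖z / 2‖ = ‖z‖ / 2 := by simp
  have h := norm_cos_sub_one_le (y := z / 2) (by rw [h2]; linarith [norm_nonneg z])
  rw [h2] at h
  rw [norm_pow]
  nlinarith [sq_nonneg ‖z‖]

lemma hasQuadraticLimit_cosIntegral (f : ℂ[X]) :
    HasQuadraticLimit (fun z => cosIntegral z f) (polyIntegral f) := by
  obtain ⟨M, hM⟩ := isCompact_Icc.exists_bound_of_continuousOn (s := Set.Icc (0 : ℝ) 1)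
    (f := fun x : ℝ => f.eval (x : ℂ)) (Continuous.continuousOn (by fun_prop))
  refine IsBigO.of_bound M ?_
  filter_upwards [Metric.ball_mem_nhds (0 : ℂ) one_pos] with z hz
  have hz' : ‖z‖ < 1 := by simpa using hz
  rw [cosIntegral_apply, polyIntegral_apply, ← intervalIntegral.integral_sub
    (Continuous.intervalIntegrable (by fun_prop) _ _)
    (Continuous.intervalIntegrable (by fun_prop) _ _)]
  have hb := intervalIntegral.norm_integral_le_of_norm_le_const (a := (0 : ℝ)) (b := 1)
    (C := M * ‖z ^ 2‖) (f := fun x : ℝ => f.eval (x : ℂ) * Complex.cos (z * (x - 1 / 2))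
      - f.eval (x : ℂ)) ?_
  · simpa using hb
  intro x hx
  rw [Set.uIoc_of_le zero_le_one] at hx
  have hfx := hM x ⟨hx.1.le, hx.2⟩
  have hx2 : ‖(x : ℂ) - 1 / 2‖ ≤ 1 := by
    rw [show (x : ℂ) - 1 / 2 = ((x - 1 / 2 : ℝ) : ℂ) by push_cast; ring, Complex.norm_real,
      Real.norm_eq_abs, abs_le]
    constructor <;> linarith [hx.1, hx.2]
  have hn : ‖z * ((x : ℂ) - 1 / 2)‖ ≤ ‖z‖ := by
    rw [norm_mul]
    exact mul_le_of_le_one_right (norm_nonneg _) hx2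
  rw [show f.eval (x : ℂ) * Complex.cos (z * (x - 1 / 2)) - f.eval (x : ℂ)
    = f.eval (x : ℂ) * (Complex.cos (z * (x - 1 / 2)) - 1) by ring, norm_mul, norm_pow]
  refine mul_le_mul hfx ((norm_cos_sub_one_le (hn.trans hz'.le)).trans ?_) (norm_nonneg _)
    ((norm_nonneg _).trans hfx)
  exact pow_le_pow_left₀ (norm_nonneg _) hn 2

/-- The entire function `sin (z/2) / z`. -/
def sincHalf (z : ℂ) : ℂ := cosIntegral z 1 / 2

/-- Pairing the derivative of the constant `1` with the sine gives `0 = 2 sin (z/2) - z ∫ cos (z (x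
- 1/2))`. No case distinction at `z = 0` is needed. -/
lemma sin_half_eq (z : ℂ) : Complex.sin (z / 2) = z * sincHalf z := by
  have h := sinIntegral_derivative z 1
  simp only [derivative_one, map_zero, eval_one] at h
  rw [sincHalf]
  linear_combination -h / 2

lemma hasQuadraticLimit_sincHalf : HasQuadraticLimit sincHalf (1 / 2) := by
  have h := (hasQuadraticLimit_cosIntegral 1).div (HasQuadraticLimit.const 2) two_ne_zero
  rw [show polyIntegral 1 = 1 by simp [polyIntegral_apply]] at h
  exact h

/-- The coefficients contain only even powers of `z`. -/
lemma hasQuadraticLimit_elementSolution (q m : ℕ) (l : ℂ[X] →ₗ[ℂ] ℂ) :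
    HasQuadraticLimit (fun z => l (elementSolution q m z)) (l (elementSolution q m 0)) := by
  simp only [elementSolution, map_sum, map_smul, smul_eq_mul]
  refine HasQuadraticLimit.sum _ fun k _ => ?_
  refine (HasQuadraticLimit.const_mul _ ?_).mul (HasQuadraticLimit.const _)
  simp only [pow_mul]
  simpa using HasQuadraticLimit.sq.pow (m - k)

lemma hasQuadraticLimit_eval_elementSolution (q m : ℕ) :
    HasQuadraticLimit (fun z => (elementSolution q m z).eval 1)
      ((elementSolution q m 0).eval 1) :=
  hasQuadraticLimit_elementSolution q m (leval 1)

lemma hasQuadraticLimit_solutionFlux (q m : ℕ) :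
    HasQuadraticLimit (solutionFlux q m) ((derivative (elementSolution q m 0)).eval 1) := by
  have h1 := hasQuadraticLimit_elementSolution q m (leval 1 ∘ₗ derivative)
  have h2 : HasQuadraticLimit (fun z => z ^ (2 * m + 2)) 0 := by
    have := HasQuadraticLimit.sq.pow (m + 1)
    simp only [← pow_mul] at this
    simpa [mul_add] using this
  have h := h1.sub (h2.mul (HasQuadraticLimit.const ((derivative^[q] (rodrigues q)).eval 1)))
  rw [zero_mul, sub_zero] at h
  exact h

/-- This is the Beta integral `B(q + 1, q + 1)`. -/
lemma polyIntegral_rodrigues (q : ℕ) :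
    polyIntegral (rodrigues q) = (q.factorial : ℂ) ^ 2 / ((2 * q + 1).factorial : ℂ) := by
  have hre : 0 < ((q : ℂ) + 1).re := by
    rw [Complex.add_re, Complex.natCast_re, Complex.one_re]; positivity
  have h := Complex.Gamma_mul_Gamma_eq_betaIntegral hre hre
  have hb : Complex.betaIntegral ((q : ℂ) + 1) ((q : ℂ) + 1) = polyIntegral (rodrigues q) := by
    rw [Complex.betaIntegral, polyIntegral_apply]
    refine intervalIntegral.integral_congr fun x _ => ?_
    simp [rodrigues, mul_pow, Complex.cpow_natCast]
  rw [hb, show (q : ℂ) + 1 + (q + 1) = ((2 * q + 1 : ℕ) : ℂ) + 1 by push_cast; ring,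
    Complex.Gamma_nat_eq_factorial, Complex.Gamma_nat_eq_factorial] at h
  rw [eq_div_iff (Nat.cast_ne_zero.2 (Nat.factorial_ne_zero _)), sq, h, mul_comm]

/-! ### Flux ratios and the dispersion error -/

/-- The ratio of flux and vertex value of `elementSolution`: an eigenvalue of the condensed element
matrix. -/
def fluxRatio (q m : ℕ) (z : ℂ) : ℂ := solutionFlux q m z / (elementSolution q m z).eval 1

/-- The leading coefficient `½ (q! / (2q)!)² / (2q+1)` of the dispersion error. -/
def dispersionCoeff (q : ℕ) : ℂ :=
  1 / 2 * ((q.factorial : ℂ) / ((2 * q).factorial : ℂ)) ^ 2 / ((2 * q + 1 : ℕ) : ℂ)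

lemma polyIntegral_rodrigues_div (q : ℕ) :
    polyIntegral (rodrigues q) / (2 * ((2 * q).factorial : ℂ)) = dispersionCoeff q := by
  have h1 : ((2 * q).factorial : ℂ) ≠ 0 := Nat.cast_ne_zero.2 (Nat.factorial_ne_zero _)
  have h2 : ((2 * q + 1 : ℕ) : ℂ) ≠ 0 := Nat.cast_ne_zero.2 (by omega)
  rw [polyIntegral_rodrigues, dispersionCoeff, Nat.factorial_succ, Nat.cast_mul]
  field_simp

/-- Scaled defect of the even discrete solution. -/
def evenDefect (m : ℕ) (z : ℂ) : ℂ :=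
  Complex.cos (z / 2) * ((-1) ^ (m + 1) * cosIntegral z (rodrigues (2 * m + 1))
    / (2 * (elementSolution (2 * m + 1) m z).eval 1))

/-- Scaled defect of the odd discrete solution. -/
def oddDefect (m : ℕ) (z : ℂ) : ℂ :=
  sincHalf z * ((-1) ^ m * cosIntegral z (rodrigues (2 * m + 2))
    / (2 * (elementSolution (2 * m + 2) m z).eval 1))

lemma eval_one_elementSolution_odd_zero_ne (m : ℕ) :
    (elementSolution (2 * m + 1) m 0).eval 1 ≠ 0 := by
  rw [eval_one_elementSolution_odd_zero]
  exact mul_ne_zero (pow_ne_zero _ (by norm_num)) (Nat.cast_ne_zero.2 (Nat.factorial_ne_zero _))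

lemma eval_one_elementSolution_even_zero_ne (m : ℕ) :
    (elementSolution (2 * m + 2) m 0).eval 1 ≠ 0 := by
  rw [eval_one_elementSolution_even_zero]
  exact div_ne_zero (mul_ne_zero (pow_ne_zero _ (by norm_num))
    (Nat.cast_ne_zero.2 (Nat.factorial_ne_zero _))) two_ne_zero

lemma hasQuadraticLimit_evenDefect (m : ℕ) :
    HasQuadraticLimit (evenDefect m) (dispersionCoeff (2 * m + 1)) := by
  have h := hasQuadraticLimit_cos_half.mul
    (((hasQuadraticLimit_cosIntegral (rodrigues (2 * m + 1))).const_mul ((-1) ^ (m + 1))).div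
      ((hasQuadraticLimit_eval_elementSolution (2 * m + 1) m).const_mul 2)
      (mul_ne_zero two_ne_zero (eval_one_elementSolution_odd_zero_ne m)))
  convert! h using 1
  rw [eval_one_elementSolution_odd_zero, ← polyIntegral_rodrigues_div]
  have h1 : ((-1 : ℂ)) ^ (m + 1) ≠ 0 := pow_ne_zero _ (by norm_num)
  field_simp

lemma hasQuadraticLimit_oddDefect (m : ℕ) :
    HasQuadraticLimit (oddDefect m) (dispersionCoeff (2 * m + 2)) := by
  have h := hasQuadraticLimit_sincHalf.mul
    (((hasQuadraticLimit_cosIntegral (rodrigues (2 * m + 2))).const_mul ((-1) ^ m)).div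
      ((hasQuadraticLimit_eval_elementSolution (2 * m + 2) m).const_mul 2)
      (mul_ne_zero two_ne_zero (eval_one_elementSolution_even_zero_ne m)))
  convert! h using 1
  rw [eval_one_elementSolution_even_zero, ← polyIntegral_rodrigues_div]
  have h1 : ((-1 : ℂ)) ^ m ≠ 0 := pow_ne_zero _ (by norm_num)
  field_simp

lemma fluxRatio_odd {m : ℕ} {z : ℂ} (h : (elementSolution (2 * m + 1) m z).eval 1 ≠ 0) :
    Complex.cos (z / 2) * (Complex.cos (z / 2) * fluxRatio (2 * m + 1) m z
        + z * Complex.sin (z / 2))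
      = z ^ (2 * (2 * m + 1) + 2) * evenDefect m z := by
  have hf := solutionFlux_odd m z
  rw [fluxRatio, evenDefect, show z ^ (2 * (2 * m + 1) + 2) = z ^ (2 * m + 2) * (z ^ 2) ^ (m + 1) by
    rw [← pow_mul, ← pow_add]; congr 1; ring]
  rw [neg_pow] at hf
  field_simp
  linear_combination 2 * Complex.cos (z / 2) * hf

lemma fluxRatio_even {m : ℕ} {z : ℂ} (h : (elementSolution (2 * m + 2) m z).eval 1 ≠ 0) :
    Complex.sin (z / 2) * (Complex.sin (z / 2) * fluxRatio (2 * m + 2) m z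
        - z * Complex.cos (z / 2))
      = z ^ (2 * (2 * m + 2) + 2) * oddDefect m z := by
  have hf := solutionFlux_even m z
  rw [fluxRatio, oddDefect, show z ^ (2 * (2 * m + 2) + 2)
    = z * z ^ (2 * m + 3) * (z ^ 2) ^ (m + 1) by
      rw [← pow_mul, ← pow_succ', ← pow_add]; congr 1; ring]
  rw [neg_pow] at hf
  have hs := sin_half_eq z
  generalize Complex.sin (z / 2) = s at *
  -- Writing the sine as `z * sincHalf z` supplies the last factor `z` of `z^(2q+2)`, with `q = 2m +
  -- 2`.
  subst hs
  field_simp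
  linear_combination 2 * z * sincHalf z * hf

lemma hasQuadraticLimit_fluxRatio_odd (m : ℕ) :
    HasQuadraticLimit (fluxRatio (2 * m + 1) m) 0 := by
  have h0 : (derivative (elementSolution (2 * m + 1) m 0)).eval 1 = 0 := by
    have := solutionFlux_odd m 0
    simpa [solutionFlux] using this
  have h := (hasQuadraticLimit_solutionFlux (2 * m + 1) m).div
    (hasQuadraticLimit_eval_elementSolution (2 * m + 1) m)
    (eval_one_elementSolution_odd_zero_ne m)
  rwa [h0, zero_div] at h

lemma hasQuadraticLimit_fluxRatio_even (m : ℕ) :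
    HasQuadraticLimit (fluxRatio (2 * m + 2) m) 2 := by
  have h0 : (derivative (elementSolution (2 * m + 2) m 0)).eval 1
      = 2 * (elementSolution (2 * m + 2) m 0).eval 1 := by
    rw [eval_one_derivative_elementSolution_even_zero, eval_one_elementSolution_even_zero]
    ring
  have hne := eval_one_elementSolution_even_zero_ne m
  have h := (hasQuadraticLimit_solutionFlux (2 * m + 2) m).div
    (hasQuadraticLimit_eval_elementSolution (2 * m + 2) m) hne
  rwa [h0, mul_div_cancel_right₀ _ hne] at h

/-- With `σ_e`, `σ_o` the eigenvalues of the condensed matrix on even and odd vertex values, the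
numerical cosine is `(σ_o + σ_e) / (σ_o - σ_e)`; this is its deviation from `cos z`. -/
lemma ratio_sub_cos (z e o : ℂ) (h : o - e ≠ 0) :
    (o + e) / (o - e) - Complex.cos z
      = 2 / (o - e) * (Complex.sin (z / 2) * (Complex.sin (z / 2) * o - z * Complex.cos (z / 2))
        + Complex.cos (z / 2) * (Complex.cos (z / 2) * e + z * Complex.sin (z / 2))) := by
  have hc : Complex.cos z = Complex.cos (z / 2) ^ 2 - Complex.sin (z / 2) ^ 2 := by
    rw [← Complex.cos_two_mul', mul_div_cancel₀ z two_ne_zero]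
  have h1 := Complex.sin_sq_add_cos_sq (z / 2)
  rw [hc]
  field_simp
  linear_combination (-(o + e)) * h1

/-- The defect `g` of index `q + 1` carries an extra `z²`, and `2 / (o - e)` tends to `1`. Hence the
error is `z^(2q+2)` times a factor `c + O(z²)`. -/
lemma ratio_dispersion_error {f g e o : ℂ → ℂ} {c d : ℂ} (q : ℕ) (he : HasQuadraticLimit e 0)
    (ho : HasQuadraticLimit o 2) (hf : HasQuadraticLimit f c) (hg : HasQuadraticLimit g d)
    (hid : ∀ᶠ z in 𝓝 (0 : ℂ),
      Complex.sin (z / 2) * (Complex.sin (z / 2) * o z - z * Complex.cos (z / 2))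
        + Complex.cos (z / 2) * (Complex.cos (z / 2) * e z + z * Complex.sin (z / 2))
      = z ^ (2 * q + 2) * f z + z ^ (2 * (q + 1) + 2) * g z) :
    (fun z => (o z + e z) / (o z - e z) - Complex.cos z - c * z ^ (2 * q + 2))
      =O[𝓝 0] fun z : ℂ => z ^ (2 * q + 4) := by
  have hoe := ho.sub he
  rw [sub_zero] at hoe
  have h : HasQuadraticLimit (fun z => 2 / (o z - e z) * (f z + z ^ 2 * g z)) c := by
    simpa using ((HasQuadraticLimit.const 2).div hoe two_ne_zero).mul
      (hf.add (HasQuadraticLimit.sq.mul hg))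
  refine ((isBigO_refl (fun z : ℂ => z ^ (2 * q + 2)) (𝓝 0)).mul h).congr' ?_ ?_
  · filter_upwards [hid, hoe.tendsto.eventually_ne two_ne_zero] with z hz hne
    rw [ratio_sub_cos z _ _ hne, hz]
    ring
  · exact Eventually.of_forall fun z => by ring

/-! ### The symmetric pair of element solutions -/

/-- Indices of the even and the odd element solution of degree at most `p`. -/
structure IsParityPair (p me mo : ℕ) : Prop where
  even_ge : p ≤ 2 * me + 1
  even_le : 2 * me + 1 ≤ p + 1
  odd_ge : p ≤ 2 * mo + 2
  odd_le : 2 * mo + 2 ≤ p + 1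

lemma exists_isParityPair {p : ℕ} (hp : 1 ≤ p) : ∃ me mo, IsParityPair p me mo := by
  rcases Nat.even_or_odd' p with ⟨k, rfl | rfl⟩
  · obtain ⟨m, rfl⟩ : ∃ m, k = m + 1 := ⟨k - 1, by omega⟩
    exact ⟨m + 1, m, by omega, by omega, by omega, by omega⟩
  · exact ⟨k, k, by omega, by omega, by omega, by omega⟩

lemma IsParityPair.dispersion_error {p me mo : ℕ} (h : IsParityPair p me mo) :
    (fun z => (fluxRatio (2 * mo + 2) mo z + fluxRatio (2 * me + 1) me z)
        / (fluxRatio (2 * mo + 2) mo z - fluxRatio (2 * me + 1) me z) - Complex.cos z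
        - dispersionCoeff p * z ^ (2 * p + 2))
      =O[𝓝 0] fun z : ℂ => z ^ (2 * p + 4) := by
  have hev := (hasQuadraticLimit_eval_elementSolution (2 * me + 1) me).tendsto.eventually_ne
    (eval_one_elementSolution_odd_zero_ne me)
  have hod := (hasQuadraticLimit_eval_elementSolution (2 * mo + 2) mo).tendsto.eventually_ne
    (eval_one_elementSolution_even_zero_ne mo)
  obtain ⟨h1, h2, h3, h4⟩ := h
  -- Of the two indices `2 me + 1` and `2 mo + 2`, one equals `p` and the other `p + 1`; the parity
  -- of `p` decides which defect leads.
  rcases (by omega : p = 2 * me + 1 ∧ me = mo ∨ p = 2 * mo + 2 ∧ me = mo + 1) with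
    ⟨rfl, rfl⟩ | ⟨rfl, rfl⟩
  · refine ratio_dispersion_error _ (hasQuadraticLimit_fluxRatio_odd _)
      (hasQuadraticLimit_fluxRatio_even _) (hasQuadraticLimit_evenDefect _)
      (hasQuadraticLimit_oddDefect me) ?_
    filter_upwards [hev, hod] with z he ho
    rw [fluxRatio_odd he, fluxRatio_even ho]
    exact add_comm _ _
  · refine ratio_dispersion_error _ (hasQuadraticLimit_fluxRatio_odd _)
      (hasQuadraticLimit_fluxRatio_even _) (hasQuadraticLimit_oddDefect _)
      (hasQuadraticLimit_evenDefect (mo + 1)) ?_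
    filter_upwards [hev, hod] with z he ho
    rw [fluxRatio_odd he, fluxRatio_even ho]
    rfl

/-- A pair of element solutions with vertex values `(1, 1)` and `(-1, 1)`, together with their
fluxes. -/
structure IsSymmetricPair (p : ℕ) (z : ℂ) (E O : ℂ[X]) (e o : ℂ) : Prop where
  even_sol : IsElementSolution p z E
  odd_sol : IsElementSolution p z O
  even_zero : E.eval 0 = 1
  even_one : E.eval 1 = 1
  odd_zero : O.eval 0 = -1
  odd_one : O.eval 1 = 1
  even_flux_one : complexForm z E X = e
  even_flux_zero : complexForm z E (1 - X) = e
  odd_flux_one : complexForm z O X = o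
  odd_flux_zero : complexForm z O (1 - X) = -o

lemma IsParityPair.isSymmetricPair {p me mo : ℕ} (h : IsParityPair p me mo) {z : ℂ}
    (he : (elementSolution (2 * me + 1) me z).eval 1 ≠ 0)
    (ho : (elementSolution (2 * mo + 2) mo z).eval 1 ≠ 0) :
    IsSymmetricPair p z
      (((elementSolution (2 * me + 1) me z).eval 1)⁻¹ • elementSolution (2 * me + 1) me z)
      (((elementSolution (2 * mo + 2) mo z).eval 1)⁻¹ • elementSolution (2 * mo + 2) mo z)
      (fluxRatio (2 * me + 1) me z) (fluxRatio (2 * mo + 2) mo z) := by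
  have s1 : (-1 : ℂ) ^ (2 * me + 1) = -1 := Odd.neg_one_pow ⟨me, rfl⟩
  have s2 : (-1 : ℂ) ^ (2 * me + 1 + 1) = 1 := by rw [pow_succ, s1]; norm_num
  have s3 : (-1 : ℂ) ^ (2 * mo + 2) = 1 := Even.neg_one_pow ⟨mo + 1, by ring⟩
  have s4 : (-1 : ℂ) ^ (2 * mo + 2 + 1) = -1 := by rw [pow_succ, s3]; norm_num
  have d0 := natDegree_one_sub_X_le
  have d1 : (X : ℂ[X]).natDegree ≤ 1 := natDegree_X_le
  obtain ⟨h1, h2, h3, h4⟩ := h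
  constructor
  · exact (isElementSolution_elementSolution (by omega) (by omega) h1 h2 z).smul _
  · exact (isElementSolution_elementSolution (by omega) (by omega) h3 h4 z).smul _
  · rw [eval_smul, eval_zero_elementSolution, s2, one_mul, smul_eq_mul, inv_mul_cancel₀ he]
  · rw [eval_smul, smul_eq_mul, inv_mul_cancel₀ he]
  · rw [eval_smul, eval_zero_elementSolution, s4, smul_eq_mul, neg_one_mul, mul_neg,
      inv_mul_cancel₀ ho]
  · rw [eval_smul, smul_eq_mul, inv_mul_cancel₀ ho]
  · rw [map_smul, LinearMap.smul_apply, complexForm_elementSolution (by omega) (by omega) z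
      (d1.trans (by omega)), s1, fluxRatio, solutionFlux]
    simp [div_eq_inv_mul]
  · rw [map_smul, LinearMap.smul_apply, complexForm_elementSolution (by omega) (by omega) z
      (d0.trans (by omega)), s1, fluxRatio, solutionFlux]
    simp [div_eq_inv_mul]
  · rw [map_smul, LinearMap.smul_apply, complexForm_elementSolution (by omega) (by omega) z
      (d1.trans (by omega)), s3, fluxRatio, solutionFlux]
    simp [div_eq_inv_mul]
  · rw [map_smul, LinearMap.smul_apply, complexForm_elementSolution (by omega) (by omega) z
      (d0.trans (by omega)), s3, fluxRatio, solutionFlux]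
    simp only [eval_sub, eval_one, eval_X]
    ring

/-- `(E - O) / 2` and `(E + O) / 2` are the element solutions with the vertex values of `1 - x` and
`x`. The condensed matrix therefore has diagonal `(e + o) / 2` and off-diagonal `(e - o) / 2`. -/
lemma IsSymmetricPair.numericalCosine_eq {p : ℕ} (hp : 1 ≤ p) {z : ℂ} {E O : ℂ[X]} {e o : ℂ}
    (h : IsSymmetricPair p z E O e o) (hA : (interiorMatrix p z).det ≠ 0) :
    numericalCosine p z = (o + e) / (o - e) := by
  have hS := condensedMatrix_eq_form hp hA
    ![(1 / 2 : ℂ) • E + (-1 / 2 : ℂ) • O, (1 / 2 : ℂ) • E + (1 / 2 : ℂ) • O]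
    (fun i => by
      fin_cases i
      · exact (h.even_sol.smul _).add (h.odd_sol.smul _)
      · exact (h.even_sol.smul _).add (h.odd_sol.smul _))
    (fun i => by
      fin_cases i <;> norm_num [vertex, h.even_zero, h.odd_zero])
    (fun i => by
      fin_cases i <;> norm_num [vertex, h.even_one, h.odd_one])
  have h00 := hS 0 0
  have h01 := hS 0 1
  have h10 := hS 1 0
  have h11 := hS 1 1
  simp only [vertex, Matrix.cons_val_zero, Matrix.cons_val_one, map_add, map_smul,
    LinearMap.add_apply, LinearMap.smul_apply, smul_eq_mul, h.even_flux_zero, h.even_flux_one,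
    h.odd_flux_zero, h.odd_flux_one] at h00 h01 h10 h11
  rw [numericalCosine, h00, h01, h10, h11, ← neg_div_neg_eq]
  congr 1 <;> ring

/-! ### Finite element functions as families of element polynomials -/

/-- `u` is given on the element `[j h, (j+1) h]` by the polynomial `q j` in the reference
coordinate. -/
def IsPiecewise (h : ℝ) (u : ℝ → ℂ) (q : ℤ → ℂ[X]) : Prop :=
  ∀ j : ℤ, ∀ x ∈ Set.Icc ((j : ℝ) * h) (((j : ℝ) + 1) * h), u x = (q j).eval ((x / h - j : ℝ) : ℂ)

lemma IsFEFunction.exists_isPiecewise {p : ℕ} {h : ℝ} (hh : 0 < h) {u : ℝ → ℂ}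
    (hu : IsFEFunction p h u) :
    ∃ q : ℤ → ℂ[X], (∀ j, (q j).natDegree ≤ p) ∧ IsPiecewise h u q := by
  choose q hq hqu using hu.2
  refine ⟨fun j => (q j).comp (C (h : ℂ) * X + C ((j * h : ℝ) : ℂ)), fun j => ?_, fun j x hx => ?_⟩
  · refine natDegree_comp_le.trans ?_
    have := natDegree_linear_le (a := (h : ℂ)) (b := ((j * h : ℝ) : ℂ))
    exact (Nat.mul_le_mul (hq j) this).trans (by simp)
  · rw [hqu j x hx, eval_comp]
    congr 1
    have : (h : ℂ) ≠ 0 := Complex.ofReal_ne_zero.2 hh.ne'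
    simp only [eval_add, eval_mul, eval_C, eval_X]
    push_cast
    field_simp
    ring

lemma IsPiecewise.node {h : ℝ} (hh : 0 < h) {u : ℝ → ℂ} {q : ℤ → ℂ[X]}
    (hu : IsPiecewise h u q) (j : ℤ) : u (j * h) = (q j).eval 0 := by
  rw [hu j _ ⟨le_rfl, by nlinarith⟩, mul_div_cancel_right₀ _ hh.ne', sub_self, Complex.ofReal_zero]

lemma IsPiecewise.node_succ {h : ℝ} (hh : 0 < h) {u : ℝ → ℂ} {q : ℤ → ℂ[X]}
    (hu : IsPiecewise h u q) (j : ℤ) : u ((j + 1) * h) = (q j).eval 1 := by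
  rw [hu j _ ⟨by nlinarith, le_rfl⟩, mul_div_cancel_right₀ _ hh.ne', add_sub_cancel_left,
    Complex.ofReal_one]

lemma IsPiecewise.eval_one_eq {h : ℝ} (hh : 0 < h) {u : ℝ → ℂ} {q : ℤ → ℂ[X]}
    (hu : IsPiecewise h u q) (j : ℤ) : (q j).eval 1 = (q (j + 1)).eval 0 := by
  rw [← hu.node_succ hh, ← hu.node hh, Int.cast_add, Int.cast_one]

lemma mem_element_floor {h : ℝ} (hh : 0 < h) (x : ℝ) :
    x ∈ Set.Icc ((⌊x / h⌋ : ℝ) * h) (((⌊x / h⌋ : ℝ) + 1) * h) :=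
  ⟨(le_div_iff₀ hh).1 (Int.floor_le _), (div_le_iff₀ hh).1 (Int.lt_floor_add_one _).le⟩

lemma locallyFinite_elements {h : ℝ} (hh : 0 < h) :
    LocallyFinite fun j : ℤ => Set.Icc ((j : ℝ) * h) (((j : ℝ) + 1) * h) := by
  refine locallyFinite_Icc_of_tendsto ?_ ?_
  · exact tendsto_intCast_atTop_atTop.atTop_mul_const hh
  · exact (tendsto_atBot_add_const_right _ 1
      (tendsto_intCast_atBot_iff.2 tendsto_id)).atBot_mul_const hh

/-- Compatible element polynomials define a finite element function. -/
lemma exists_isFEFunction {p : ℕ} {h : ℝ} (hh : 0 < h) (r : ℤ → ℂ[X])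
    (hr : ∀ j, (r j).natDegree ≤ p) (hc : ∀ j, (r j).eval 1 = (r (j + 1)).eval 0) :
    ∃ v, IsFEFunction p h v ∧ IsPiecewise h v r := by
  set v : ℝ → ℂ := fun x => (r ⌊x / h⌋).eval ((x / h - ⌊x / h⌋ : ℝ) : ℂ) with hv
  have hpw : IsPiecewise h v r := by
    intro j x hx
    have h1 : (j : ℝ) ≤ x / h := (le_div_iff₀ hh).2 hx.1
    have h2 : x / h ≤ j + 1 := (div_le_iff₀ hh).2 hx.2
    rcases h2.lt_or_eq with h3 | h3
    · have : ⌊x / h⌋ = j := Int.floor_eq_iff.2 ⟨h1, h3⟩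
      simp only [hv, this]
    -- At the right endpoint the floor already selects the next element; compatibility makes the two
    -- values agree.
    · have : ⌊x / h⌋ = j + 1 := by
        rw [h3, ← Int.cast_one, ← Int.cast_add, Int.floor_intCast]
      simp only [hv, this]
      rw [h3]
      simpa using (hc j).symm
  refine ⟨v, ⟨?_, fun j => ?_⟩, hpw⟩
  · refine (locallyFinite_elements hh).continuous ?_ (fun _ => isClosed_Icc) fun j => ?_
    · exact Set.eq_univ_of_forall fun x => Set.mem_iUnion.2 ⟨_, mem_element_floor hh x⟩
    · refine ContinuousOn.congr (Continuous.continuousOn ?_) (hpw j)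
      fun_prop
  · refine ⟨(r j).comp (C (h : ℂ)⁻¹ * X + C (-(j : ℂ))), ?_, fun x hx => ?_⟩
    · refine natDegree_comp_le.trans ?_
      have := natDegree_linear_le (a := (h : ℂ)⁻¹) (b := -(j : ℂ))
      exact (Nat.mul_le_mul (hr j) this).trans (by simp)
    · rw [hpw j x hx, eval_comp]
      congr 1
      simp only [eval_add, eval_mul, eval_C, eval_X]
      push_cast
      ring

lemma IsPiecewise.eq_zero_of_notMem {h : ℝ} (hh : 0 < h) {v : ℝ → ℂ} {r : ℤ → ℂ[X]}
    (hv : IsPiecewise h v r) {M : ℕ} (hr : ∀ j : ℤ, j < -M ∨ (M : ℤ) ≤ j → r j = 0) {x : ℝ}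
    (hx : x ∉ Set.Icc (-(M : ℝ) * h) (M * h)) : v x = 0 := by
  rw [hv _ x (mem_element_floor hh x), hr, eval_zero]
  rw [Set.mem_Icc, not_and_or, not_le, not_le, ← div_lt_iff₀ hh, ← lt_div_iff₀ hh] at hx
  rcases hx with hx | hx
  · left
    rw [Int.floor_lt]
    push_cast
    exact hx
  · right
    rw [Int.le_floor]
    push_cast
    exact hx.le

lemma IsPiecewise.hasCompactSupport {h : ℝ} (hh : 0 < h) {v : ℝ → ℂ} {r : ℤ → ℂ[X]}
    (hv : IsPiecewise h v r) {M : ℕ} (hr : ∀ j : ℤ, j < -M ∨ (M : ℤ) ≤ j → r j = 0) :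
    HasCompactSupport v :=
  HasCompactSupport.intro isCompact_Icc fun _ hx => hv.eq_zero_of_notMem hh hr hx

lemma IsPiecewise.exists_bound {h : ℝ} (hh : 0 < h) {v : ℝ → ℂ} {r : ℤ → ℂ[X]}
    (hv : IsPiecewise h v r) (hc : HasCompactSupport v) :
    ∃ M : ℕ, ∀ j : ℤ, j < -M ∨ (M : ℤ) ≤ j → r j = 0 := by
  obtain ⟨R, hR⟩ := hc.isCompact.isBounded.subset_closedBall 0
  obtain ⟨M, hM⟩ := exists_nat_gt (R / h)
  rw [div_lt_iff₀ hh] at hM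
  refine ⟨M, fun j hj => ?_⟩
  have hzero : ∀ t ∈ Set.Ioo (0 : ℝ) 1, (r j).eval (t : ℂ) = 0 := by
    intro t ht
    have hx := hv j ((j + t) * h) ⟨by nlinarith [ht.1], by nlinarith [ht.2]⟩
    rw [mul_div_cancel_right₀ _ hh.ne', add_sub_cancel_left] at hx
    rw [← hx]
    by_contra hne
    have hmem := hR (subset_tsupport v hne)
    rw [mem_closedBall_zero_iff, Real.norm_eq_abs, abs_le] at hmem
    rcases hj with hj | hj
    · have : (j : ℝ) + 1 ≤ -M := by exact_mod_cast hj
      nlinarith [ht.2]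
    · have : (M : ℝ) ≤ j := by exact_mod_cast hj
      nlinarith [ht.1]
  refine eq_zero_of_infinite_isRoot _ (Set.Infinite.mono ?_
    ((Set.Ioo_infinite (zero_lt_one' ℝ)).image Complex.ofReal_injective.injOn))
  rintro _ ⟨t, ht, rfl⟩
  exact hzero t ht

lemma IsPiecewise.hasDerivAt {h : ℝ} {u : ℝ → ℂ} {q : ℤ → ℂ[X]}
    (hu : IsPiecewise h u q) (j : ℤ) {x : ℝ}
    (hx : x ∈ Set.Ioo ((j : ℝ) * h) (((j : ℝ) + 1) * h)) :
    HasDerivAt u ((h : ℂ)⁻¹ * (q j).derivative.eval ((x / h - j : ℝ) : ℂ)) x := by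
  have hlin : HasDerivAt (fun y : ℝ => y / h - j) h⁻¹ x := by
    simpa using ((hasDerivAt_id x).div_const h).sub_const (j : ℝ)
  have hd := (hasDerivAt_eval_ofReal (q j) (x / h - j)).scomp x hlin
  rw [Complex.real_smul, Complex.ofReal_inv] at hd
  refine hd.congr_of_eventuallyEq ?_
  filter_upwards [isOpen_Ioo.mem_nhds hx] with y hy
  exact hu j y (Set.Ioo_subset_Icc_self hy)

/-- The integrand of `helmholtzForm`. -/
def helmholtzDensity (ω : ℂ) (u v : ℝ → ℂ) (x : ℝ) : ℂ :=
  deriv u x * (starRingEnd ℂ) (deriv v x) - ω ^ 2 * (u x * (starRingEnd ℂ) (v x))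

lemma eval_map_conj (f : ℂ[X]) (t : ℝ) :
    (f.map (starRingEnd ℂ)).eval (t : ℂ) = (starRingEnd ℂ) (f.eval (t : ℂ)) := by
  have := eval_map_apply (starRingEnd ℂ) (p := f) (t : ℂ)
  rwa [Complex.conj_ofReal] at this

lemma IsPiecewise.density_eq {h : ℝ} (hh : 0 < h) {u v : ℝ → ℂ} {q r : ℤ → ℂ[X]}
    (hu : IsPiecewise h u q) (hv : IsPiecewise h v r) (ω : ℂ) (j : ℤ) {x : ℝ}
    (hx : x ∈ Set.Ioo ((j : ℝ) * h) (((j : ℝ) + 1) * h)) :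
    helmholtzDensity ω u v x = ((h : ℂ)⁻¹ ^ 2 • (derivative (q j)
        * derivative ((r j).map (starRingEnd ℂ))
      - (ω * h) ^ 2 • (q j * (r j).map (starRingEnd ℂ)))).eval ((x / h - j : ℝ) : ℂ) := by
  have hc : (h : ℂ) ≠ 0 := Complex.ofReal_ne_zero.2 hh.ne'
  rw [helmholtzDensity, (hu.hasDerivAt j hx).deriv, (hv.hasDerivAt j hx).deriv,
    hu j x (Set.Ioo_subset_Icc_self hx), hv j x (Set.Ioo_subset_Icc_self hx), derivative_map]
  simp only [eval_smul, eval_sub, eval_mul, eval_map_conj, map_mul, map_inv₀, Complex.conj_ofReal,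
    smul_eq_mul]
  field_simp

lemma IsPiecewise.intervalIntegrable_density {h : ℝ} (hh : 0 < h) {u v : ℝ → ℂ} {q r : ℤ → ℂ[X]}
    (hu : IsPiecewise h u q) (hv : IsPiecewise h v r) (ω : ℂ) (j : ℤ) :
    IntervalIntegrable (helmholtzDensity ω u v) volume (j * h) ((j + 1) * h) := by
  have hle : (j : ℝ) * h ≤ (j + 1) * h := by nlinarith
  refine (intervalIntegrable_congr_uIoo (Set.uIoo_of_le hle ▸ fun x hx =>
    hu.density_eq hh hv ω j hx)).2 (Continuous.intervalIntegrable (by fun_prop) _ _)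

lemma IsPiecewise.integral_density {h : ℝ} (hh : 0 < h) {u v : ℝ → ℂ} {q r : ℤ → ℂ[X]}
    (hu : IsPiecewise h u q) (hv : IsPiecewise h v r) (ω : ℂ) (j : ℤ) :
    ∫ x in (j * h)..((j + 1) * h), helmholtzDensity ω u v x
      = (h : ℂ)⁻¹ * complexForm (ω * h) (q j) ((r j).map (starRingEnd ℂ)) := by
  have hc : (h : ℂ) ≠ 0 := Complex.ofReal_ne_zero.2 hh.ne'
  have hle : (j : ℝ) * h ≤ (j + 1) * h := by nlinarith
  -- Only the open element matters, so the value of `deriv` at mesh points, where it may be the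
  -- default, plays no role.
  rw [intervalIntegral.integral_congr_Ioo_of_le hle fun x hx => hu.density_eq hh hv ω j hx]
  set G := (h : ℂ)⁻¹ ^ 2 • (derivative (q j) * derivative ((r j).map (starRingEnd ℂ))
      - (ω * h) ^ 2 • (q j * (r j).map (starRingEnd ℂ))) with hG
  rw [intervalIntegral.integral_comp_div_sub (fun t : ℝ => G.eval (t : ℂ)) hh.ne' (j : ℝ),
    mul_div_cancel_right₀ _ hh.ne', mul_div_cancel_right₀ _ hh.ne', sub_self, add_sub_cancel_left,
    ← polyIntegral_apply, hG, map_smul, map_sub, map_smul, complexForm_apply,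
    Complex.real_smul, smul_eq_mul, smul_eq_mul]
  field_simp

/-- The global form is a sum of element forms. -/
lemma IsPiecewise.helmholtzForm_eq {h : ℝ} (hh : 0 < h) {u v : ℝ → ℂ} {q r : ℤ → ℂ[X]}
    (hu : IsPiecewise h u q) (hv : IsPiecewise h v r) (ω : ℂ) {M : ℕ}
    (hr : ∀ j : ℤ, j < -M ∨ (M : ℤ) ≤ j → r j = 0) :
    helmholtzForm ω u v = (h : ℂ)⁻¹ * ∑ n ∈ Finset.range (2 * M),
      complexForm (ω * h) (q (n - M)) ((r (n - M)).map (starRingEnd ℂ)) := by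
  have hsupp : ∀ x ∉ Set.Icc (-(M : ℝ) * h) (M * h), helmholtzDensity ω u v x = 0 := by
    intro x hx
    have hev : v =ᶠ[𝓝 x] fun _ => 0 := by
      filter_upwards [isClosed_Icc.isOpen_compl.mem_nhds hx] with y hy
      exact hv.eq_zero_of_notMem hh hr hy
    rw [helmholtzDensity, hev.deriv_eq, hv.eq_zero_of_notMem hh hr hx]
    simp
  have hle : -(M : ℝ) * h ≤ M * h := by nlinarith [(Nat.cast_nonneg M : (0 : ℝ) ≤ M)]
  have h1 : helmholtzForm ω u v = ∫ x in (-(M : ℝ) * h)..(M * h), helmholtzDensity ω u v x := by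
    rw [intervalIntegral.integral_of_le hle, ← integral_Icc_eq_integral_Ioc,
      setIntegral_eq_integral_of_forall_compl_eq_zero hsupp]
    rfl
  have hcast : ∀ n : ℕ, ((n : ℝ) - M) = (((n : ℤ) - M : ℤ) : ℝ) := fun n => by push_cast; rfl
  have h2 := intervalIntegral.sum_integral_adjacent_intervals (μ := volume)
    (f := helmholtzDensity ω u v) (a := fun n : ℕ => ((n : ℝ) - M) * h) (n := 2 * M) (by
      intro n _
      have := hu.intervalIntegrable_density hh hv ω ((n : ℤ) - M)
      rw [← hcast] at this
      convert! this using 2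
      push_cast
      ring)
  rw [h1, Finset.mul_sum]
  have e0 : ((0 : ℕ) - M : ℝ) * h = -(M : ℝ) * h := by push_cast; ring
  have e1 : ((2 * M : ℕ) - M : ℝ) * h = M * h := by push_cast; ring
  simp only [e0, e1] at h2
  rw [← h2]
  refine Finset.sum_congr rfl fun n _ => ?_
  rw [← hu.integral_density hh hv ω ((n : ℤ) - M), ← hcast]
  congr 1
  push_cast
  ring

lemma natDegree_map_conj_le {p : ℕ} {f : ℂ[X]} (hf : f.natDegree ≤ p) :
    (f.map (starRingEnd ℂ)).natDegree ≤ p := natDegree_map_le.trans hf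

lemma map_conj_map_conj (f : ℂ[X]) : (f.map (starRingEnd ℂ)).map (starRingEnd ℂ) = f := by
  rw [Polynomial.map_map]
  ext n
  simp

lemma eval_zero_map_conj (f : ℂ[X]) :
    (f.map (starRingEnd ℂ)).eval 0 = (starRingEnd ℂ) (f.eval 0) := by
  simp

lemma eval_one_map_conj (f : ℂ[X]) :
    (f.map (starRingEnd ℂ)).eval 1 = (starRingEnd ℂ) (f.eval 1) := by
  simp

/-- A discrete solution satisfies the element equations around the node `0`. -/
lemma IsPiecewise.patch_equation {p : ℕ} {h : ℝ} (hh : 0 < h) {ω : ℂ} {u : ℝ → ℂ} {q : ℤ → ℂ[X]}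
    (hu : IsPiecewise h u q)
    (hsol : ∀ v : ℝ → ℂ, IsFEFunction p h v → HasCompactSupport v → helmholtzForm ω u v = 0)
    {f g : ℂ[X]} (hf : f.natDegree ≤ p) (hg : g.natDegree ≤ p) (hf0 : f.eval 0 = 0)
    (hg1 : g.eval 1 = 0) (hfg : f.eval 1 = g.eval 0) :
    complexForm (ω * h) (q (-1)) f + complexForm (ω * h) (q 0) g = 0 := by
  -- The test pieces are conjugated in advance, because the global form conjugates its second
  -- argument and `complexForm` does not.
  set r : ℤ → ℂ[X] := fun j => if j = -1 then f.map (starRingEnd ℂ) else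
    if j = 0 then g.map (starRingEnd ℂ) else 0 with hrdef
  have hdeg : ∀ j, (r j).natDegree ≤ p := by
    intro j
    simp only [hrdef]
    split_ifs
    · exact natDegree_map_conj_le hf
    · exact natDegree_map_conj_le hg
    · simp
  have hcomp : ∀ j, (r j).eval 1 = (r (j + 1)).eval 0 := by
    intro j
    rcases (by omega : j = -1 ∨ j = 0 ∨ j = -2 ∨ (j ≠ -1 ∧ j ≠ 0 ∧ j + 1 ≠ -1 ∧ j + 1 ≠ 0)) with
      rfl | rfl | rfl | ⟨h1, h2, h3, h4⟩
    · simp [hrdef, hfg]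
    · simp [hrdef, hg1]
    · simp [hrdef, hf0]
    · simp [hrdef, h1, h2, h3, h4]
  obtain ⟨v, hv, hvr⟩ := exists_isFEFunction hh r hdeg hcomp
  have hr : ∀ j : ℤ, j < -(1 : ℕ) ∨ ((1 : ℕ) : ℤ) ≤ j → r j = 0 := by
    intro j hj
    have h1 : j ≠ -1 := by omega
    have h2 : j ≠ 0 := by omega
    simp [hrdef, h1, h2]
  have hz := hsol v hv (hvr.hasCompactSupport hh hr)
  rw [hu.helmholtzForm_eq hh hvr ω hr] at hz
  have hs := (mul_eq_zero.1 hz).resolve_left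
    (inv_ne_zero (Complex.ofReal_ne_zero.2 hh.ne'))
  simpa [Finset.sum_range_succ, hrdef, map_conj_map_conj] using hs

/-! ### The discrete dispersion relation -/

section Symmetric

variable {p : ℕ} {z : ℂ} {E O : ℂ[X]} {e o : ℂ}

/-- Since the form is symmetric, testing `q` against `E` and `O` equals testing `E` and `O` against
`q`. This gives the sum and the difference of the two fluxes of `q`. -/
lemma IsSymmetricPair.flux_one (hp : 1 ≤ p) (hS : IsSymmetricPair p z E O e o) {q : ℂ[X]}
    (hq : IsElementSolution p z q) :
    complexForm z q X
      = ((q.eval 0 + q.eval 1) * e + (q.eval 1 - q.eval 0) * o) / 2 := by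
  have h1 := complexForm_comm z q E
  have h2 := complexForm_comm z q O
  rw [hq.form_eq hp hS.even_sol.1, hS.even_sol.form_eq hp hq.1, hS.even_flux_zero,
    hS.even_flux_one, hS.even_zero, hS.even_one] at h1
  rw [hq.form_eq hp hS.odd_sol.1, hS.odd_sol.form_eq hp hq.1, hS.odd_flux_zero,
    hS.odd_flux_one, hS.odd_zero, hS.odd_one] at h2
  linear_combination h1 / 2 + h2 / 2

lemma IsSymmetricPair.flux_zero (hp : 1 ≤ p) (hS : IsSymmetricPair p z E O e o) {q : ℂ[X]}
    (hq : IsElementSolution p z q) :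
    complexForm z q (1 - X)
      = ((q.eval 0 + q.eval 1) * e - (q.eval 1 - q.eval 0) * o) / 2 := by
  have h1 := complexForm_comm z q E
  have h2 := complexForm_comm z q O
  rw [hq.form_eq hp hS.even_sol.1, hS.even_sol.form_eq hp hq.1, hS.even_flux_zero,
    hS.even_flux_one, hS.even_zero, hS.even_one] at h1
  rw [hq.form_eq hp hS.odd_sol.1, hS.odd_sol.form_eq hp hq.1, hS.odd_flux_zero,
    hS.odd_flux_one, hS.odd_zero, hS.odd_one] at h2
  linear_combination h1 / 2 - h2 / 2

end Symmetric

lemma planeWave_add (b k : ℂ) (h : ℝ) (j : ℤ) :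
    b * Complex.exp (Complex.I * ((j - 1 : ℤ) : ℂ) * k * h)
        + b * Complex.exp (Complex.I * ((j + 1 : ℤ) : ℂ) * k * h)
      = 2 * Complex.cos (k * h) * (b * Complex.exp (Complex.I * (j : ℂ) * k * h)) := by
  have e1 : Complex.I * ((j - 1 : ℤ) : ℂ) * k * h = Complex.I * j * k * h + -(k * h) * Complex.I := by
    push_cast; ring
  have e2 : Complex.I * ((j + 1 : ℤ) : ℂ) * k * h = Complex.I * j * k * h + k * h * Complex.I := by
    push_cast; ring
  rw [e1, e2, Complex.exp_add, Complex.exp_add, Complex.two_cos]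
  ring

/-- Discrete dispersion relation: the discrete wave numbers are the solutions `k` of
`cos (k h) = (σ_o + σ_e) / (σ_o - σ_e)`. -/
theorem IsSymmetricPair.isDiscreteWaveNumber_iff {p : ℕ} (hp : 1 ≤ p) {h : ℝ} (hh : 0 < h)
    {ω : ℂ} {E O : ℂ[X]} {e o : ℂ} (hS : IsSymmetricPair p (ω * h) E O e o) (hne : o - e ≠ 0)
    (k : ℂ) :
    IsDiscreteWaveNumber p h ω k ↔ Complex.cos (k * h) = (o + e) / (o - e) := by
  constructor
  · rintro ⟨u, hu, ⟨b, hb, hnode⟩, hsol⟩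
    obtain ⟨q, hq, hpw⟩ := hu.exists_isPiecewise hh
    have hq1 : IsElementSolution p (ω * h) (q (-1)) := ⟨hq _, fun g hg h0 h1 => by
      simpa using hpw.patch_equation hh hsol hg (g := 0) (by simp) h0 (by simp) (by simpa using h1)⟩
    have hq0 : IsElementSolution p (ω * h) (q 0) := ⟨hq _, fun g hg h0 h1 => by
      simpa using
        hpw.patch_equation hh hsol (f := 0) (by simp) hg (by simp) h1 (by simpa using h0.symm)⟩
    -- The hat function at node `0` expresses the balance of the fluxes from the two adjacent
    -- elements.
    have hpatch := hpw.patch_equation hh hsol (f := X) (g := 1 - X) (natDegree_vertex_le hp 1)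
      (natDegree_vertex_le hp 0) (by simp) (by simp) (by simp)
    rw [hS.flux_one hp hq1, hS.flux_zero hp hq0] at hpatch
    have hwave := planeWave_add b k h 0
    rw [← hnode, ← hnode, ← hnode] at hwave
    have v0 : u ((0 : ℤ) * h) = (q 0).eval 0 := hpw.node hh 0
    have v1 : u (((0 + 1 : ℤ) : ℝ) * h) = (q 0).eval 1 := by
      rw [hpw.node hh, ← hpw.eval_one_eq hh]
    have vm : u (((0 - 1 : ℤ) : ℝ) * h) = (q (-1)).eval 0 := hpw.node hh (0 - 1)
    have vm1 : (q (-1)).eval 1 = (q 0).eval 0 := hpw.eval_one_eq hh (-1)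
    have hq00 : (q 0).eval 0 ≠ 0 := by
      rw [← v0, hnode]
      exact mul_ne_zero hb (Complex.exp_ne_zero _)
    rw [v0, v1, vm] at hwave
    rw [vm1] at hpatch
    rw [eq_div_iff hne]
    refine mul_right_cancel₀ hq00 ?_
    linear_combination -hpatch - (o - e) / 2 * hwave
  · intro hcos
    rw [eq_div_iff hne] at hcos
    set ξ : ℤ → ℂ := fun j => 1 * Complex.exp (Complex.I * (j : ℂ) * k * h) with hξ
    set q : ℤ → ℂ[X] := fun j => ((ξ j + ξ (j + 1)) / 2) • E + ((ξ (j + 1) - ξ j) / 2) • O with hq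
    have hqs : ∀ j, IsElementSolution p (ω * h) (q j) := fun j =>
      (hS.even_sol.smul _).add (hS.odd_sol.smul _)
    have q0 : ∀ j, (q j).eval 0 = ξ j := fun j => by
      simp only [hq, eval_add, eval_smul, hS.even_zero, hS.odd_zero, smul_eq_mul]; ring
    have q1 : ∀ j, (q j).eval 1 = ξ (j + 1) := fun j => by
      simp only [hq, eval_add, eval_smul, hS.even_one, hS.odd_one, smul_eq_mul]; ring
    obtain ⟨u, hu, hpw⟩ := exists_isFEFunction hh q (fun j => (hqs j).1) fun j => by rw [q0, q1]
    refine ⟨u, hu, ⟨1, one_ne_zero, fun j => ?_⟩, fun v hv hvc => ?_⟩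
    · rw [hpw.node hh, q0]
    obtain ⟨r, hr, hvr⟩ := hv.exists_isPiecewise hh
    obtain ⟨M, hM⟩ := hvr.exists_bound hh hvc
    rw [hpw.helmholtzForm_eq hh hvr ω hM]
    -- `A j` is the flux at node `j` from the element on its left, times the conjugate nodal value
    -- of `v`. The cosine equation makes the flux from the right its negative, hence the
    -- telescoping.
    set A : ℤ → ℂ := fun j => ((ξ (j - 1) + ξ j) * e + (ξ j - ξ (j - 1)) * o) / 2
      * (starRingEnd ℂ) ((r j).eval 0) with hA
    have hterm : ∀ j, complexForm (ω * h) (q j) ((r j).map (starRingEnd ℂ)) = A (j + 1) - A j := by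
      intro j
      have hwave : ξ (j - 1) + ξ (j + 1) = 2 * Complex.cos (k * h) * ξ j := planeWave_add 1 k h j
      rw [(hqs j).form_eq hp (natDegree_map_conj_le (hr j)), hS.flux_zero hp (hqs j),
        hS.flux_one hp (hqs j), eval_zero_map_conj, eval_one_map_conj, q0, q1]
      simp only [hA, add_sub_cancel_right, hvr.eval_one_eq hh j]
      linear_combination (starRingEnd ℂ) ((r j).eval 0)
        * ((e - o) / 2 * hwave - ξ j * hcos)
    have hlast : r M = 0 := hM M (Or.inr le_rfl)
    -- `r (-M)` itself need not vanish; its left vertex value does, by continuity with the zero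
    -- piece `-M - 1`.
    have hfirst : (r (-M)).eval 0 = 0 := by
      have := hvr.eval_one_eq hh (-M - 1)
      rw [hM (-M - 1) (Or.inl (by omega)), sub_add_cancel] at this
      simpa using this.symm
    have hsum := Finset.sum_range_sub (fun n : ℕ => A (n - M)) (2 * M)
    have e1 : ((2 * M : ℕ) : ℤ) - M = M := by push_cast; ring
    have e0 : ((0 : ℕ) : ℤ) - M = -M := by simp
    simp only [hterm]
    rw [e1, e0] at hsum
    have hAM : A M = 0 := by simp [hA, hlast]
    have hA0 : A (-M) = 0 := by simp [hA, hfirst]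
    rw [hAM, hA0, sub_zero] at hsum
    rw [← mul_zero (h : ℂ)⁻¹, ← hsum]
    congr 1
    refine Finset.sum_congr rfl fun n _ => ?_
    rw [show ((n : ℤ) - M + 1) = ((n + 1 : ℕ) : ℤ) - M by push_cast; ring]

end HpFEM

end

theorem mainTheorem1 (p : ℕ) (hp : 1 ≤ p) :
    ∃ δ : ℝ, 0 < δ ∧ ∃ C : ℝ, 0 < C ∧
      ∀ (h : ℝ) (ω : ℂ), 0 < h → ‖ω * (h : ℂ)‖ < δ →
        (∀ k : ℂ, HpFEM.IsDiscreteWaveNumber p h ω k ↔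
          Complex.cos (k * (h : ℂ)) = HpFEM.numericalCosine p (ω * (h : ℂ))) ∧
        ‖HpFEM.numericalCosine p (ω * (h : ℂ)) - Complex.cos (ω * (h : ℂ))
            - (1 / 2 : ℂ) * ((Nat.factorial p : ℂ) / (Nat.factorial (2 * p) : ℂ)) ^ 2
              * ((ω * (h : ℂ)) ^ (2 * p + 2) / ((2 * p + 1 : ℕ) : ℂ))‖
          ≤ C * ‖ω * (h : ℂ)‖ ^ (2 * p + 4) := by
  obtain ⟨me, mo, hpar⟩ := HpFEM.exists_isParityPair hp
  obtain ⟨C, hC, hbound⟩ := hpar.dispersion_error.exists_pos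
  have hev := (HpFEM.hasQuadraticLimit_eval_elementSolution (2 * me + 1) me).tendsto.eventually_ne
    (HpFEM.eval_one_elementSolution_odd_zero_ne me)
  have hod := (HpFEM.hasQuadraticLimit_eval_elementSolution (2 * mo + 2) mo).tendsto.eventually_ne
    (HpFEM.eval_one_elementSolution_even_zero_ne mo)
  have hdiff := ((HpFEM.hasQuadraticLimit_fluxRatio_even mo).sub
    (HpFEM.hasQuadraticLimit_fluxRatio_odd me)).tendsto.eventually_ne (by norm_num : (2 - 0 : ℂ) ≠ 0)
  obtain ⟨δ, hδ, hball⟩ := Metric.eventually_nhds_iff.1 (hev.and (hod.and (hdiff.and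
    ((HpFEM.eventually_interiorMatrix_det_ne_zero p).and hbound.bound))))
  refine ⟨δ, hδ, C, hC, fun h ω hh hz => ?_⟩
  obtain ⟨he, ho, hne, hA, hb⟩ := hball (y := ω * h) (by simpa using hz)
  have hS := hpar.isSymmetricPair he ho
  rw [hS.numericalCosine_eq hp hA]
  refine ⟨hS.isDiscreteWaveNumber_iff hp hh hne, ?_⟩
  rw [norm_pow] at hb
  convert! hb using 3
  rw [HpFEM.dispersionCoeff]
  ring
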